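/- Let $H=\{z\in\mathbb C:\operatorname{Im} z>0\}$. For a function $f$ on $H$, an integer $k\ge 0$ and $\gamma=\begin{pmatrix}a&b\\c&d\end{pmatrix}\in GL^+(2,\mathbb Q)$ put $(f|_k\gamma)(z)=\det(\gamma)^{k/2}\,f\!\left(\frac{az+b}{cz+d}\right)(cz+d)^{-k}$. Let $\Delta(z)=(2\pi)^{12}\eta(z)^{24}$, with $\eta$ the Dedekind eta function, and $$\mu_\gamma(z)=\frac1{12\pi i}\,\frac{d}{dz}\log\frac{\Delta|_{12}\gamma}{\Delta}(z).$$ For $\mathbf a\in(\mathbb Q/\mathbb Z)^2$ and $z\in H$ consider $$G_{\mathbf a}(z,s)=\sum_{\mathbf m\in\mathbb Q^2\setminus\mathbf 0,\ \mathbf m\equiv\mathbf a\bmod\mathbb Z^2}(m_1z+m_2)^{-2}|m_1z+m_2|^{-s},\qquad \operatorname{Re}s>0 .$$ This series converges absolutely and has an analytic continuation to (a connected open set containing $\operatorname{Re}s>0$ and) $s=0$; let $G_{\mathbf a}(z)$ be the value of the continuation at $s=0$. For $\mathbf x=(x_1,x_2)\in(\mathbb Q/\mathbb Z)^2$ and any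 integer $N\ge1$ with $N\mathbf x=\mathbf 0$ put $$\phi_{\mathbf x}(z)=\frac{1}{4\pi^2N^2}\sum_{j_1,j_2=0}^{N-1}e^{2\pi i(j_2x_1-j_1x_2)}\,G_{(j_1/N,\,j_2/N)}(z),$$ which does not depend on the choice of $N$. In particular $\phi_{\mathbf 0}=\frac1{4\pi^2}G_{\mathbf 0}$ is the non-holomorphic Eisenstein series of weight $2$. Then for every $\gamma\in GL^+(2,\mathbb Q)$ $$\mu_\gamma=2\,(\phi_{\mathbf 0}|_2\gamma-\phi_{\mathbf 0}).$$ If moreover $\gamma$ has integer entries, let $\check\gamma=\det(\gamma)\,\gamma^{-1}$; then there are only finitely many $\mathbf y\in(\mathbb Q/\mathbb Z)^2$ (row vectors) with $\mathbf y\cdot\check\gamma=\mathbf 0$, and $$\mu_\gamma=2\,(\phi_{\mathbf 0}|_2\gamma-\phi_{\mathbf 0})=2\Big(\sum_{\mathbf y\cdot\check\gamma=\mathbf 0}\phi_{\mathbf y}-\phi_{\mathbf 0}\Big).$$ -/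

import Mathlib

open UpperHalfPlane
open scoped MatrixGroups

noncomputable section

namespace HeckeEisenstein

/-- The image in `GL(2, ℝ)` of an element of `GL⁺(2, ℚ)`. -/
def toReal (γ : GL(2, ℚ)⁺) : GL (Fin 2) ℝ :=
  Matrix.GeneralLinearGroup.map (algebraMap ℚ ℝ) (γ : GL (Fin 2) ℚ)

/-- The slash operator of weight `k`, normalized by `det ^ (k / 2)`:
`(f|_k γ)(z) = det(γ)^{k/2} f(γ z) (c z + d)^{-k}`. Here `γ • z = (a z + b) / (c z + d)` because
`det γ > 0`, and `denom γ z = c z + d`. -/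
def slash (k : ℕ) (f : ℍ → ℂ) (γ : GL(2, ℚ)⁺) (z : ℍ) : ℂ :=
  (((toReal γ).det.val ^ ((k : ℝ) / 2) : ℝ) : ℂ) * f (toReal γ • z) *
    (denom (toReal γ) z ^ k)⁻¹

/-- The discriminant cusp form `Δ = (2π)^12 η^24` of weight 12. -/
def Delta (z : ℍ) : ℂ := (2 * (Real.pi : ℂ)) ^ 12 * ModularForm.eta z ^ 24

/-- `μ_γ = (1 / (12 π i)) d/dz log ((Δ|γ) / Δ)`. -/
def mu (γ : GL(2, ℚ)⁺) (z : ℍ) : ℂ :=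
  1 / (12 * (Real.pi : ℂ) * Complex.I) *
    logDeriv (fun w : ℂ => slash 12 Delta γ (ofComplex w) / Delta (ofComplex w)) (z : ℂ)

/-- The group `(ℚ/ℤ)²`. -/
abbrev S : Type := Fin 2 → AddCircle (1 : ℚ)

/-- The nonzero `m ∈ ℚ²` that are congruent to `a` modulo `ℤ²`. -/
def coset (a : S) : Set (Fin 2 → ℚ) :=
  {m | m ≠ 0 ∧ ∀ i, ((m i : ℚ) : AddCircle (1 : ℚ)) = a i}

/-- The term `(m₁ z + m₂)^{-2} |m₁ z + m₂|^{-s}`. -/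
def term (z : ℍ) (s : ℂ) (m : Fin 2 → ℚ) : ℂ :=
  (((m 0 : ℂ) * (z : ℂ) + (m 1 : ℂ)) ^ 2)⁻¹ *
    ((‖(m 0 : ℂ) * (z : ℂ) + (m 1 : ℂ)‖ : ℝ) : ℂ) ^ (-s)

/-- `F` is holomorphic on a connected open set that contains the half-plane `Re s > 0` and the
point `0`, and on `Re s > 0` it is the sum of the series
`G_a(z, s) = ∑_{m ≡ a, m ≠ 0} (m₁ z + m₂)^{-2} |m₁ z + m₂|^{-s}`. -/
def IsContinuation (a : S) (z : ℍ) (F : ℂ → ℂ) : Prop :=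
  ∃ U : Set ℂ, IsOpen U ∧ IsPreconnected U ∧ {s : ℂ | 0 < s.re} ⊆ U ∧ (0 : ℂ) ∈ U ∧
    DifferentiableOn ℂ F U ∧
    ∀ s : ℂ, 0 < s.re → HasSum (fun m : coset a => term z s m) (F s)

/-- The value at `s = 0` does not depend on the continuation. -/
theorem IsContinuation.value_unique {a : S} {z : ℍ} {F F' : ℂ → ℂ}
    (h : IsContinuation a z F) (h' : IsContinuation a z F') : F 0 = F' 0 := by
  obtain ⟨U, hU, -, -, h0, hF, hs⟩ := h
  obtain ⟨U', hU', -, -, h0', hF', hs'⟩ := h'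
  have hc : ContinuousAt F 0 := (hF.differentiableAt (hU.mem_nhds h0)).continuousAt
  have hc' : ContinuousAt F' 0 := (hF'.differentiableAt (hU'.mem_nhds h0')).continuousAt
  have hl : Filter.Tendsto (fun t : ℝ => (t : ℂ)) (nhdsWithin 0 (Set.Ioi 0)) (nhds 0) := by
    have : Filter.Tendsto (fun t : ℝ => (t : ℂ)) (nhds 0) (nhds ((0 : ℝ) : ℂ)) :=
      Complex.continuous_ofReal.tendsto 0
    simpa using this.mono_left nhdsWithin_le_nhds
  refine tendsto_nhds_unique (hc.tendsto.comp hl) ((hc'.tendsto.comp hl).congr' ?_)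
  filter_upwards [self_mem_nhdsWithin] with t ht
  have ht' : 0 < (t : ℂ).re := by simpa using ht
  exact (hs' _ ht').unique (hs _ ht')

open Classical in
/-- `G_a(z)`, the value at `s = 0` of the analytic continuation of `G_a(z, s)`. -/
def G (a : S) (z : ℍ) : ℂ :=
  if h : ∃ F : ℂ → ℂ, IsContinuation a z F then h.choose 0 else 0

/-- `φ_0 = (1 / 4π²) G_0`, the non-holomorphic Eisenstein series of weight 2. -/
def phiZero (z : ℍ) : ℂ := 1 / (4 * (Real.pi : ℂ) ^ 2) * G 0 z

theorem expQ_periodic : Function.Periodic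
    (fun q : ℚ => Complex.exp (2 * Real.pi * Complex.I * (q : ℂ))) 1 := by
  intro q
  have : (2 * Real.pi * Complex.I * ((q + 1 : ℚ) : ℂ)) =
      2 * Real.pi * Complex.I * (q : ℂ) + 2 * Real.pi * Complex.I := by
    push_cast
    ring
  simp only [this, Complex.exp_periodic _]

/-- The character `x ↦ e^{2 π i x}` of `ℚ/ℤ`. -/
def expQ : AddCircle (1 : ℚ) → ℂ := expQ_periodic.lift

/-- The twisted Eisenstein series formed at level `N`, for `x ∈ ((1/N)ℤ/ℤ)²`:
`(1 / (4π² N²)) ∑_j e^{2πi (j₂ x₁ - j₁ x₂)} G_{j/N}`, where `j/N` runs through `((1/N)ℤ/ℤ)²`. -/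
def phiLevel (N : ℕ) (x : S) (z : ℍ) : ℂ :=
  1 / (4 * (Real.pi : ℂ) ^ 2 * (N : ℂ) ^ 2) *
    ∑ j : Fin 2 → Fin N,
      expQ ((j 1 : ℕ) • x 0 - (j 0 : ℕ) • x 1) *
        G (fun i => (((j i : ℕ) : ℚ) / (N : ℚ) : ℚ)) z

/-- Hecke's twisted Eisenstein series `φ_x`, formed at the least level `N` with `N x = 0`. -/
def phi (x : S) (z : ℍ) : ℂ := phiLevel (addOrderOf x) x z

theorem phi_zero : phi 0 = phiZero := by
  funext z
  have he : expQ 0 = 1 := by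
    have := expQ_periodic.lift_coe 0
    simpa [expQ] using this
  unfold phi
  rw [addOrderOf_zero]
  unfold phiLevel phiZero
  simp [he]
  rfl

/-- The row vector `y ∈ (ℚ/ℤ)²` times an integral matrix. -/
def rowMul (y : S) (A : Matrix (Fin 2) (Fin 2) ℤ) : S :=
  fun j => ∑ i, A i j • y i

end HeckeEisenstein

end

/-! The first formula needs no modularity. The logarithmic derivative of `η` is `πi E₂/12`, so the
chain rule writes `μ_γ` through `E₂(γz)`, `E₂(z)` and a term `c/(cz+d)` coming from the automorphy
factor. On the other side `φ_0 = E₂/12 - 1/(4π Im z)`, and `Im γz = det γ · Im z/|cz+d|²` turns the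
non-holomorphic parts into exactly that term (`mu_eq`).

The formula for `φ_0` rests on an explicit continuation of `G_a(z, s)`. From each term of a row `m₁
≠ 0` its mean over a unit interval in `m₂` is subtracted. The differences gain one order of decay
and converge for `Re s > -1/2`. The subtracted integrals tile the line; `integral_kern` evaluates
each row as a factor `s` times `|m₁|^{-1-s}` and a function holomorphic near `0`, and the sum over
rows is `s` times an even Hurwitz zeta function. The pole at `s = 0` cancels and leaves `-π/Im z`,
while for `a = 0` the differences add up to Eisenstein's `G2`.

For the second formula, `4π² φ_x` is the limit as `s → 0+` of the series over `ℤ²` twisted by the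
character `n ↦ e^{2πi(n₂x₁ - n₁x₂)}`, for every admissible level (`tendsto_twisted`). The characters
with `yγ̌ = 0` are those trivial on `ℤ²γ`, and there are `det γ` of them. By orthogonality
(`sum_latticeChar`) the sum of their twisted series is `det γ` times the series over `ℤ²γ`, which is
the untwisted series at `γz` times `(cz+d)^{-2}|cz+d|^{-s}`. Letting `s → 0+` gives `φ_0|γ`
(`sum_phi_eq_slash`). -/

noncomputable section

namespace HeckeEisenstein

/-! ### The kernel `(uz+v)^{-2}|uz+v|^{-s}`: derivative in `v` and dependence on `s`. -/

section

open MeasureTheory Filter Topology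

/-- Holomorphy of `s ↦ ∫ g(t) e^{-s L(t)}` on a half-plane of absolute convergence. -/
theorem differentiableOn_integral_mul_cexp {μ : Measure ℝ} {g : ℝ → ℂ} {L : ℝ → ℝ}
    (hL : Continuous L) {c : ℝ}
    (h : ∀ s : ℂ, c < s.re → Integrable (fun t => g t * Complex.exp (-s * L t)) μ) :
    DifferentiableOn ℂ (fun s => ∫ t, g t * Complex.exp (-s * L t) ∂μ) {s | c < s.re} := by
  intro s₀ hs₀
  refine DifferentiableAt.differentiableWithinAt ?_
  have hs₀' : c < s₀.re := hs₀
  obtain ⟨r, hr, hrc⟩ : ∃ r : ℝ, 0 < r ∧ c + 2 * r < s₀.re :=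
    ⟨(s₀.re - c) / 3, by linarith, by linarith⟩
  -- Differentiation in `s` brings down `L`, and `r|L| ≤ e^{r|L|}`. For `|s - s₀| < r` the
  -- derivative is thus dominated by the integrand at `s₀ - 2r` where `L ≥ 0` and at `s₀ + 2r` where
  -- `L ≤ 0`.
  have h1 := (h (s₀ - 2 * r) (by simp; linarith)).norm
  have h2 := (h (s₀ + 2 * r) (by simp; linarith)).norm
  have hnorm : ∀ (s : ℂ) (t : ℝ), ‖g t * Complex.exp (-s * L t)‖ =
      ‖g t‖ * Real.exp (-s.re * L t) := by
    intro s t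
    rw [norm_mul, Complex.norm_exp]
    simp
  refine (hasDerivAt_integral_of_dominated_loc_of_deriv_le (s := Metric.ball s₀ r)
    (F' := fun s t => g t * (Complex.exp (-s * L t) * (-(L t : ℂ))))
    (bound := fun t => r⁻¹ * (‖g t * Complex.exp (-(s₀ - 2 * r) * L t)‖ +
      ‖g t * Complex.exp (-(s₀ + 2 * r) * L t)‖)) (Metric.ball_mem_nhds s₀ hr) ?_ (h s₀ hs₀) ?_ ?_
      ((h1.add h2).const_mul _) ?_).2.differentiableAt
  · filter_upwards [(isOpen_lt continuous_const Complex.continuous_re).mem_nhds hs₀] with s hs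
    exact (h s hs).aestronglyMeasurable
  · have := (h s₀ hs₀).aestronglyMeasurable.mul
      (f := fun t => g t * Complex.exp (-s₀ * L t)) (g := fun t => -(L t : ℂ))
      (Continuous.aestronglyMeasurable (by fun_prop))
    refine this.congr (Eventually.of_forall fun t => ?_)
    simp [mul_assoc]
  · refine Eventually.of_forall fun t s hs => ?_
    rw [hnorm, hnorm, ← mul_assoc, norm_mul, hnorm, norm_neg, Complex.norm_real, Real.norm_eq_abs]
    have hd : |s.re - s₀.re| < r := by
      have := Complex.abs_re_le_norm (s - s₀)
      rw [Complex.sub_re] at this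
      exact this.trans_lt (by simpa [dist_eq_norm] using hs)
    rw [abs_lt] at hd
    simp only [Complex.sub_re, Complex.add_re, Complex.mul_re, Complex.re_ofNat, Complex.ofReal_re,
      Complex.im_ofNat, Complex.ofReal_im, mul_zero, sub_zero]
    rw [inv_mul_eq_div, le_div_iff₀ hr, ← mul_add, mul_assoc, mul_assoc]
    refine mul_le_mul_of_nonneg_left ?_ (norm_nonneg _)
    have e1 : |L t| * r ≤ Real.exp (r * |L t|) := by
      nlinarith [Real.add_one_le_exp (r * |L t|)]
    have e2 : Real.exp (-s.re * L t) * (|L t| * r) ≤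
        Real.exp (-s.re * L t) * Real.exp (r * |L t|) := by gcongr
    refine e2.trans ?_
    rw [← Real.exp_add]
    rcases le_total 0 (L t) with hl | hl
    · rw [abs_of_nonneg hl]
      have : Real.exp (-s.re * L t + r * L t) ≤ Real.exp (-(s₀.re - 2 * r) * L t) := by
        apply Real.exp_le_exp.2; nlinarith
      linarith [Real.exp_pos (-(s₀.re + 2 * r) * L t)]
    · rw [abs_of_nonpos hl]
      have : Real.exp (-s.re * L t + r * -L t) ≤ Real.exp (-(s₀.re + 2 * r) * L t) := by
        apply Real.exp_le_exp.2; nlinarith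
      linarith [Real.exp_pos (-(s₀.re - 2 * r) * L t)]
  · refine Eventually.of_forall fun t s _ => ?_
    refine HasDerivAt.const_mul _ ?_
    have : HasDerivAt (fun s : ℂ => -s * (L t : ℂ)) (-(L t : ℂ)) s := by
      simpa using (hasDerivAt_neg s).mul_const (L t : ℂ)
    exact this.cexp

/-- The term of the Eisenstein series as a function of real variables. -/
def kern (z : ℍ) (s : ℂ) (u v : ℝ) : ℂ :=
  (((u : ℂ) * z + v) ^ 2)⁻¹ * ((‖(u : ℂ) * z + v‖ : ℝ) : ℂ) ^ (-s)

theorem term_eq_kern (z : ℍ) (s : ℂ) (m : Fin 2 → ℚ) : term z s m = kern z s (m 0) (m 1) := by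
  simp [term, kern]

@[simp] theorem kern_zero_zero (z : ℍ) (s : ℂ) : kern z s 0 0 = 0 := by simp [kern]

theorem linear_ne_zero_of_left_ne (z : ℍ) {u : ℝ} (hu : u ≠ 0) (v : ℝ) : (u : ℂ) * z + v ≠ 0 := by
  intro h
  have := congrArg Complex.im h
  simp [hu, z.im_ne_zero] at this

theorem linear_ne_zero_of_ne (z : ℍ) {u v : ℝ} (h : u ≠ 0 ∨ v ≠ 0) : (u : ℂ) * z + v ≠ 0 := by
  by_cases hu : u = 0
  · subst hu; simpa using h
  · exact linear_ne_zero_of_left_ne z hu v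

theorem ofReal_norm_cpow {w : ℂ} (hw : w ≠ 0) (s : ℂ) :
    ((‖w‖ : ℝ) : ℂ) ^ (-s) = Complex.exp (-s * (Real.log ‖w‖ : ℝ)) := by
  rw [Complex.cpow_def_of_ne_zero (by simpa using hw), Complex.ofReal_log (norm_nonneg _), mul_comm]

theorem norm_kern {z : ℍ} {u v : ℝ} (h : u ≠ 0 ∨ v ≠ 0) (s : ℂ) :
    ‖kern z s u v‖ = ‖(u : ℂ) * z + v‖ ^ (-(2 + s.re)) := by
  have hw := norm_pos_iff.2 (linear_ne_zero_of_ne z h)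
  rw [kern, norm_mul, norm_inv, norm_pow, Complex.norm_cpow_eq_rpow_re_of_pos hw, neg_add,
    Real.rpow_add hw, Real.rpow_neg hw.le]
  simp

theorem hasDerivAt_linear (z : ℍ) (u t : ℝ) :
    HasDerivAt (fun t : ℝ => (u : ℂ) * z + t) 1 t := by
  simpa using (Complex.ofRealCLM.hasDerivAt (x := t)).const_add ((u : ℂ) * z)

theorem hasDerivAt_norm_cpow (z : ℍ) (s : ℂ) {u : ℝ} (hu : u ≠ 0) (t : ℝ) :
    HasDerivAt (fun t : ℝ => ((‖(u : ℂ) * z + t‖ : ℝ) : ℂ) ^ (-s))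
      (((‖(u : ℂ) * z + t‖ : ℝ) : ℂ) ^ (-s) *
        (-s * (((u * z.re + t) / ‖(u : ℂ) * z + t‖ ^ 2 : ℝ) : ℂ))) t := by
  have hn : ∀ t : ℝ, ‖(u : ℂ) * z + t‖ ^ 2 = (u * z.re + t) ^ 2 + (u * z.im) ^ 2 := by
    intro t
    rw [← Complex.normSq_eq_norm_sq, Complex.normSq_apply]
    simp; ring
  have hl : ∀ t : ℝ, Real.log ‖(u : ℂ) * z + t‖ =
      1 / 2 * Real.log ((u * z.re + t) ^ 2 + (u * z.im) ^ 2) := by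
    intro t; rw [← hn, Real.log_pow]; push_cast; ring
  have hpos : 0 < (u * z.re + t) ^ 2 + (u * z.im) ^ 2 := by
    rw [← hn]; exact pow_pos (norm_pos_iff.2 (linear_ne_zero_of_left_ne z hu t)) 2
  simp_rw [fun t : ℝ => ofReal_norm_cpow (linear_ne_zero_of_left_ne z hu t) s]
  refine HasDerivAt.cexp (HasDerivAt.const_mul _ (HasDerivAt.ofReal_comp ?_))
  simp_rw [hl, hn]
  have h1 : HasDerivAt (fun t : ℝ => (u * z.re + t) ^ 2 + (u * z.im) ^ 2)
      (2 * (u * z.re + t)) t := by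
    simpa using (((hasDerivAt_id t).const_add (u * z.re)).pow 2).add_const ((u * z.im) ^ 2)
  refine ((h1.log hpos.ne').const_mul (1 / 2)).congr_deriv ?_
  ring

theorem continuous_kern (z : ℍ) (s : ℂ) {u : ℝ} (hu : u ≠ 0) : Continuous (kern z s u) := by
  have h1 : Continuous fun t : ℝ => ((‖(u : ℂ) * z + t‖ : ℝ) : ℂ) ^ (-s) :=
    continuous_iff_continuousAt.2 fun t => (hasDerivAt_norm_cpow z s hu t).continuousAt
  refine Continuous.mul (Continuous.inv₀ (by fun_prop) fun t => ?_) h1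
  exact pow_ne_zero 2 (linear_ne_zero_of_left_ne z hu t)

theorem abs_re_div_norm_sq_le (w : ℂ) : |w.re / ‖w‖ ^ 2| ≤ ‖w‖⁻¹ := by
  rw [abs_div, abs_of_nonneg (by positivity : 0 ≤ ‖w‖ ^ 2)]
  rcases eq_or_ne w 0 with rfl | hw
  · simp
  have := norm_pos_iff.2 hw
  rw [div_le_iff₀ (by positivity)]
  calc |w.re| ≤ ‖w‖ := Complex.abs_re_le_norm w
    _ = ‖w‖⁻¹ * ‖w‖ ^ 2 := by field_simp

/-- The derivative decays one order faster than the kernel; this gain is what carries the lattice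
sum past `s = 0`. -/
theorem exists_hasDerivAt_kern (z : ℍ) (s : ℂ) {u : ℝ} (hu : u ≠ 0) (t : ℝ) :
    ∃ d : ℂ, HasDerivAt (kern z s u) d t ∧
      ‖d‖ ≤ (2 + ‖s‖) * ‖(u : ℂ) * z + t‖ ^ (-(3 + s.re)) := by
  have hw := linear_ne_zero_of_left_ne z hu t
  have hw' := norm_pos_iff.2 hw
  have h1 := ((hasDerivAt_linear z u t).pow 2).inv (pow_ne_zero 2 hw)
  refine ⟨_, h1.mul (hasDerivAt_norm_cpow z s hu t), ?_⟩
  have hN : ‖((‖(u : ℂ) * z + t‖ : ℝ) : ℂ) ^ (-s)‖ = ‖(u : ℂ) * z + t‖ ^ (-s.re) := by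
    rw [Complex.norm_cpow_eq_rpow_re_of_pos hw']; simp
  have hre : u * z.re + t = ((u : ℂ) * z + t).re := by simp
  have hb := abs_re_div_norm_sq_le ((u : ℂ) * z + t)
  refine (norm_add_le _ _).trans ?_
  have e3 : ‖(u : ℂ) * z + t‖ ^ (-(3 + s.re)) =
      (‖(u : ℂ) * z + t‖ ^ 3)⁻¹ * ‖(u : ℂ) * z + t‖ ^ (-s.re) := by
    rw [neg_add, Real.rpow_add hw', Real.rpow_neg hw'.le]; norm_cast
  rw [e3]
  simp only [norm_mul, norm_div, norm_neg, norm_pow, norm_inv, hN, Complex.norm_real, hre,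
    Real.norm_eq_abs, Pi.inv_apply, Pi.pow_apply]
  set n := ‖(u : ℂ) * z + t‖
  set A := n ^ (-s.re)
  have hA : 0 ≤ A := by positivity
  have k1 : (n ^ 2)⁻¹ * (A * (‖s‖ * (|((u : ℂ) * z + t).re| / |n| ^ 2))) ≤
      (n ^ 2)⁻¹ * (A * (‖s‖ * n⁻¹)) := by
    rw [abs_div, abs_pow] at hb
    gcongr
  have k2 : (n ^ 2)⁻¹ * (A * (‖s‖ * n⁻¹)) = ‖s‖ * ((n ^ 3)⁻¹ * A) := by
    field_simp
  have k3 : (2 + ‖s‖) * ((n ^ 3)⁻¹ * A) = 2 * ((n ^ 3)⁻¹ * A) + ‖s‖ * ((n ^ 3)⁻¹ * A) := by ring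
  rw [k3]
  refine add_le_add (le_of_eq ?_) (k1.trans k2.le)
  simp
  field_simp

end

/-! ### Integrals of the kernel along a row. -/

section

open MeasureTheory Filter Topology

/-- The integral `∫ (1 + t²)^{-1-s/2} dt`. -/
def rowIntegral (s : ℂ) : ℂ :=
  ∫ t : ℝ, (((1 + t ^ 2)⁻¹ : ℝ) : ℂ) * Complex.exp (-s * ((1 / 2 * Real.log (1 + t ^ 2) : ℝ) : ℂ))

theorem integrable_rowIntegrand {s : ℂ} (hs : -1 < s.re) : Integrable fun t : ℝ =>
    (((1 + t ^ 2)⁻¹ : ℝ) : ℂ) *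
      Complex.exp (-s * ((1 / 2 * Real.log (1 + t ^ 2) : ℝ) : ℂ)) := by
  have hp : ∀ t : ℝ, 1 + t ^ 2 ≠ 0 := fun t => by positivity
  have h := integrable_rpow_neg_one_add_norm_sq (E := ℝ) (μ := volume) (r := 2 + s.re)
    (by simp; linarith)
  refine h.mono' (Continuous.aestronglyMeasurable ?_) (Eventually.of_forall fun t => le_of_eq ?_)
  · have : Continuous fun t : ℝ => (1 + t ^ 2)⁻¹ := by fun_prop (disch := assumption)
    fun_prop (disch := assumption)
  · have hpos : 0 < 1 + t ^ 2 := by positivity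
    rw [norm_mul, Complex.norm_exp, Complex.norm_real, Real.norm_eq_abs, abs_of_pos (by positivity),
      Real.norm_eq_abs, sq_abs, show -(2 + s.re) / 2 = -1 + -s.re / 2 by ring, Real.rpow_add hpos,
      Real.rpow_neg_one, Real.rpow_def_of_pos hpos]
    congr 2
    simp
    ring

theorem differentiableOn_rowIntegral : DifferentiableOn ℂ rowIntegral {s | -1 < s.re} := by
  have hp : ∀ t : ℝ, 1 + t ^ 2 ≠ 0 := fun t => by positivity
  exact differentiableOn_integral_mul_cexp (by fun_prop (disch := assumption))
    fun s hs => integrable_rowIntegrand hs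

theorem rowIntegral_zero : rowIntegral 0 = Real.pi := by
  simp only [rowIntegral, neg_zero, zero_mul, Complex.exp_zero, mul_one]
  rw [← integral_univ_inv_one_add_sq]
  exact integral_ofReal

/-- `|u z + t|^{-2-s}` in terms of the integrand of `rowIntegral`. -/
theorem norm_pow_eq_rowIntegrand (z : ℍ) (s : ℂ) {u : ℝ} (hu : u ≠ 0) (t : ℝ) :
    (((‖(u : ℂ) * z + t‖ ^ 2)⁻¹ : ℝ) : ℂ) * ((‖(u : ℂ) * z + t‖ : ℝ) : ℂ) ^ (-s) =
      (((|u| * z.im : ℝ) : ℂ) ^ (-2 - s)) *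
      ((((1 + (|u * z.im|⁻¹ * (t + u * z.re)) ^ 2)⁻¹ : ℝ) : ℂ) * Complex.exp (-s *
        ((1 / 2 * Real.log (1 + (|u * z.im|⁻¹ * (t + u * z.re)) ^ 2) : ℝ) : ℂ))) := by
  have hy := z.im_pos
  have hb : 0 < |u| * z.im := by positivity
  have hab : |u * z.im| = |u| * z.im := by rw [abs_mul, abs_of_pos hy]
  have hn : ‖(u : ℂ) * z + t‖ ^ 2 =
      (|u| * z.im) ^ 2 * (1 + ((|u| * z.im)⁻¹ * (t + u * z.re)) ^ 2) := by
    rw [← Complex.normSq_eq_norm_sq, Complex.normSq_apply]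
    have : (|u| * z.im) ^ 2 = (u * z.im) ^ 2 := by rw [mul_pow, sq_abs, mul_pow]
    rw [mul_add, ← mul_pow, mul_inv_cancel_left₀ hb.ne', mul_one, this]
    simp; ring
  rw [hab]
  set b := |u| * z.im
  set X := 1 + (b⁻¹ * (t + u * z.re)) ^ 2
  have hX : 0 < X := by positivity
  have hl : Real.log ‖(u : ℂ) * z + t‖ = Real.log b + 1 / 2 * Real.log X := by
    have : 2 * Real.log ‖(u : ℂ) * z + t‖ = 2 * Real.log b + Real.log X := by
      have h2 := congrArg Real.log hn
      rw [Real.log_mul (by positivity) hX.ne', Real.log_pow, Real.log_pow] at h2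
      exact_mod_cast h2
    linarith
  rw [ofReal_norm_cpow (linear_ne_zero_of_left_ne z hu t), hl, hn, Complex.cpow_sub _ _
    (by exact_mod_cast hb.ne'), Complex.cpow_def_of_ne_zero (y := s) (by exact_mod_cast hb.ne'),
    ← Complex.ofReal_log hb.le, Complex.ofReal_add, mul_add (-s), Complex.exp_add,
    mul_comm (Real.log b : ℂ) s, neg_mul, Complex.exp_neg]
  have : (b : ℂ) ^ (-2 : ℂ) = ((b : ℂ) ^ 2)⁻¹ := by
    rw [Complex.cpow_neg]; norm_cast
  rw [this]
  push_cast
  field_simp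

theorem integrable_norm_pow (z : ℍ) {s : ℂ} (hs : -1 < s.re) {u : ℝ} (hu : u ≠ 0) :
    Integrable fun t : ℝ =>
      (((‖(u : ℂ) * z + t‖ ^ 2)⁻¹ : ℝ) : ℂ) * ((‖(u : ℂ) * z + t‖ : ℝ) : ℂ) ^ (-s) := by
  simp_rw [norm_pow_eq_rowIntegrand z s hu]
  have hb : |u * z.im|⁻¹ ≠ 0 := by simp [hu, z.im_ne_zero]
  exact (((integrable_rowIntegrand hs).comp_mul_left' hb).comp_add_right (u * z.re)).const_mul _

theorem integral_norm_pow (z : ℍ) (s : ℂ) {u : ℝ} (hu : u ≠ 0) :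
    ∫ t : ℝ, (((‖(u : ℂ) * z + t‖ ^ 2)⁻¹ : ℝ) : ℂ) * ((‖(u : ℂ) * z + t‖ : ℝ) : ℂ) ^ (-s) =
      ((|u| * z.im : ℝ) : ℂ) ^ (-1 - s) * rowIntegral s := by
  have hb : 0 < |u| * z.im := by have := z.im_pos; positivity
  simp_rw [norm_pow_eq_rowIntegrand z s hu]
  rw [integral_const_mul, integral_add_right_eq_self (fun t : ℝ =>
      (((1 + (|u * z.im|⁻¹ * t) ^ 2)⁻¹ : ℝ) : ℂ) * Complex.exp (-s *
        ((1 / 2 * Real.log (1 + (|u * z.im|⁻¹ * t) ^ 2) : ℝ) : ℂ))),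
    Measure.integral_comp_mul_left (fun t : ℝ =>
      (((1 + t ^ 2)⁻¹ : ℝ) : ℂ) * Complex.exp (-s * ((1 / 2 * Real.log (1 + t ^ 2) : ℝ) : ℂ))),
    inv_inv, abs_abs, abs_mul, abs_of_pos z.im_pos, ← rowIntegral, Complex.real_smul, ← mul_assoc]
  congr 1
  rw [show -1 - s = (-2 - s) + 1 by ring, Complex.cpow_add _ _ (by exact_mod_cast hb.ne'),
    Complex.cpow_one]

theorem integrable_kern (z : ℍ) {s : ℂ} (hs : -1 < s.re) {u : ℝ} (hu : u ≠ 0) :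
    Integrable (kern z s u) := by
  refine (integrable_norm_pow z hs hu).mono (continuous_kern z s hu).aestronglyMeasurable
    (Eventually.of_forall fun t => le_of_eq ?_)
  rw [kern, norm_mul, norm_mul, norm_inv, norm_pow, Complex.norm_real, norm_inv, norm_pow,
    norm_norm]

theorem tendsto_norm_linear (z : ℍ) (u : ℝ) {l : Filter ℝ}
    (hl : Tendsto (fun t : ℝ => |t|) l atTop) :
    Tendsto (fun t : ℝ => ‖(u : ℂ) * z + t‖) l atTop := by
  refine tendsto_atTop_mono (f := fun t : ℝ => |t| - ‖(u : ℂ) * z‖) (fun t => ?_)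
    (tendsto_atTop_add_const_right _ _ hl)
  have := norm_sub_norm_le (t : ℂ) (-((u : ℂ) * z))
  rw [norm_neg, Complex.norm_real, Real.norm_eq_abs, sub_neg_eq_add, add_comm (t : ℂ)] at this
  exact this

/-- With `w = uz + t`, the function `w^{-1}|w|^{-s}` vanishes at both ends of the line, and since
`Re w = (w + w̄)/2` its derivative combines `w^{-2}|w|^{-s}` and `|w|^{-2-s}`. This reduces the
integral to the positive one. The resulting factor `s` will cancel the pole of the zeta function and
makes the integral vanish at `s = 0`. -/
theorem integral_kern (z : ℍ) {s : ℂ} (hs : -1 < s.re) {u : ℝ} (hu : u ≠ 0) :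
    ∫ t, kern z s u t =
      -(s / (2 + s)) * (((|u| * z.im : ℝ) : ℂ) ^ (-1 - s) * rowIntegral s) := by
  have h2s : 2 + s ≠ 0 := by
    intro h
    have := congrArg Complex.re h
    simp at this
    linarith
  let p : ℝ → ℂ := fun t => ((u : ℂ) * z + t)⁻¹ * ((‖(u : ℂ) * z + t‖ : ℝ) : ℂ) ^ (-s)
  let q : ℝ → ℂ := fun t =>
    (((‖(u : ℂ) * z + t‖ ^ 2)⁻¹ : ℝ) : ℂ) * ((‖(u : ℂ) * z + t‖ : ℝ) : ℂ) ^ (-s)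
  have hderiv : ∀ t, HasDerivAt p (-(1 + s / 2) * kern z s u t - s / 2 * q t) t := by
    intro t
    have hw := linear_ne_zero_of_left_ne z hu t
    refine (((hasDerivAt_linear z u t).inv hw).mul (hasDerivAt_norm_cpow z s hu t)).congr_deriv ?_
    simp only [kern, q, Pi.inv_apply]
    set w := (u : ℂ) * z + t with hwdef
    have hre : ((u * z.re + t : ℝ) : ℂ) = (w + (starRingEnd ℂ) w) / 2 := by
      rw [← Complex.re_eq_add_conj]; simp [hwdef]
    have hnn : ((‖w‖ : ℝ) : ℂ) ^ 2 = w * (starRingEnd ℂ) w := by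
      rw [Complex.mul_conj, Complex.normSq_eq_norm_sq]; push_cast; rfl
    have hc : (starRingEnd ℂ) w ≠ 0 := by simpa using hw
    rw [Complex.ofReal_div, hre]
    push_cast
    rw [hnn]
    generalize ((‖w‖ : ℝ) : ℂ) ^ (-s) = A
    field_simp
    ring
  have hint : Integrable fun t => -(1 + s / 2) * kern z s u t - s / 2 * q t :=
    ((integrable_kern z hs hu).const_mul _).sub ((integrable_norm_pow z hs hu).const_mul _)
  have hlim : ∀ l : Filter ℝ, Tendsto (fun t : ℝ => |t|) l atTop → Tendsto p l (𝓝 0) := by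
    intro l hl
    rw [tendsto_zero_iff_norm_tendsto_zero]
    have := (tendsto_rpow_neg_atTop (y := 1 + s.re) (by linarith)).comp (tendsto_norm_linear z u hl)
    refine this.congr fun t => ?_
    have hw := norm_pos_iff.2 (linear_ne_zero_of_left_ne z hu t)
    simp only [p, norm_mul, norm_inv, Complex.norm_cpow_eq_rpow_re_of_pos hw, Function.comp]
    rw [neg_add, Real.rpow_add hw, Real.rpow_neg_one]
    simp
  have key := integral_of_hasDerivAt_of_tendsto hderiv hint (hlim _ tendsto_abs_atBot_atTop)
    (hlim _ tendsto_abs_atTop_atTop)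
  rw [integral_sub ((integrable_kern z hs hu).const_mul _)
    ((integrable_norm_pow z hs hu).const_mul _), integral_const_mul, integral_const_mul,
    integral_norm_pow z s hu] at key
  field_simp
  linear_combination (-2 : ℂ) * key

theorem differentiable_intervalIntegral_kern (z : ℍ) {u : ℝ} (hu : u ≠ 0) (v : ℝ) :
    Differentiable ℂ fun s => ∫ t in (0 : ℝ)..1, kern z s u (v + t) := by
  have hL : Continuous fun t : ℝ => Real.log ‖(u : ℂ) * z + ((v + t : ℝ) : ℂ)‖ :=
    Continuous.log (by fun_prop) fun t => norm_ne_zero_iff.2 (linear_ne_zero_of_left_ne z hu _)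
  have hk : ∀ s t, kern z s u (v + t) = (((u : ℂ) * z + ((v + t : ℝ) : ℂ)) ^ 2)⁻¹ *
      Complex.exp (-s * (Real.log ‖(u : ℂ) * z + ((v + t : ℝ) : ℂ)‖ : ℝ)) := by
    intro s t
    rw [kern, ofReal_norm_cpow (linear_ne_zero_of_left_ne z hu _)]
  intro s
  have := differentiableOn_integral_mul_cexp (μ := volume.restrict (Set.Ioc 0 1)) hL
    (g := fun t => (((u : ℂ) * z + ((v + t : ℝ) : ℂ)) ^ 2)⁻¹) (c := s.re - 1) (fun s _ => by
      simp_rw [← hk]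
      exact (((continuous_kern z s hu).comp (continuous_const.add continuous_id)).integrableOn_Icc
        ).mono_set Set.Ioc_subset_Icc_self)
  simp_rw [hk, intervalIntegral.integral_of_le zero_le_one]
  exact this.differentiableAt
    ((isOpen_lt continuous_const Complex.continuous_re).mem_nhds (by simp))

end

/-! ### Convergence for `Re s > -1/2` of the lattice sum with row means removed. -/

section

open MeasureTheory Filter Topology

/-- Provides a bound uniform in the exponent `k`, hence in `s` on bounded sets: the constant uses
the largest exponent, the decay the smallest. -/
theorem rpow_neg_le_of_le {c X Y k k₀ k₁ : ℝ} (hc : 0 < c) (hc1 : c ≤ 1) (hX : 1 ≤ X)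
    (hY : c * X ≤ Y) (hk : k₀ ≤ k) (hk0 : 0 ≤ k) (hk1 : k ≤ k₁) :
    Y ^ (-k) ≤ c ^ (-k₁) * X ^ (-k₀) := by
  have hX0 : 0 < X := by linarith
  calc Y ^ (-k) ≤ (c * X) ^ (-k) :=
        Real.rpow_le_rpow_of_nonpos (by positivity) hY (by linarith)
    _ = c ^ (-k) * X ^ (-k) := Real.mul_rpow hc.le hX0.le
    _ ≤ c ^ (-k₁) * X ^ (-k₀) := by
        gcongr ?_ * ?_
        · exact Real.rpow_le_rpow_of_exponent_ge hc hc1 (by linarith)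
        · exact Real.rpow_le_rpow_of_exponent_le hX (by linarith)

theorem one_le_norm_int_vec {x : Fin 2 → ℤ} (hx : x ≠ 0) : 1 ≤ ‖x‖ := by
  obtain ⟨i, hi⟩ := Function.ne_iff.1 hx
  have h1 : (1 : ℝ) ≤ ‖x i‖ := by
    rw [Int.norm_eq_abs]
    exact_mod_cast Int.one_le_abs hi
  exact h1.trans (norm_le_pi_norm x i)

/-- The coordinate `A / N + p` of a lattice point. -/
def pt (N : ℕ) (A p : ℤ) : ℝ := (A : ℝ) / N + p

/-- The numerators of a lattice point. -/
def numer (N : ℕ) (A B : ℤ) (x : ℤ × ℤ) : Fin 2 → ℤ := ![A + N * x.1, B + N * x.2]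

variable {N : ℕ} {A B : ℤ}

theorem pt_eq_div (hN : 0 < N) (A p : ℤ) : pt N A p = ((A + N * p : ℤ) : ℝ) / N := by
  have : (N : ℝ) ≠ 0 := by positivity
  rw [pt]; push_cast; field_simp

theorem pt_eq_zero_iff (hN : 0 < N) (A p : ℤ) : pt N A p = 0 ↔ A + N * p = 0 := by
  have : (N : ℝ) ≠ 0 := by positivity
  rw [pt_eq_div hN, div_eq_zero_iff]
  simp only [this, or_false]
  exact_mod_cast Iff.rfl

theorem pt_injective (N : ℕ) (A : ℤ) : Function.Injective (pt N A) := by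
  intro p q h
  simpa [pt] using h

theorem numer_injective (hN : 0 < N) (A B : ℤ) : Function.Injective (numer N A B) := by
  have : (N : ℤ) ≠ 0 := by exact_mod_cast hN.ne'
  rintro ⟨p, q⟩ ⟨p', q'⟩ h
  have h0 := congrFun h 0
  have h1 := congrFun h 1
  simp only [numer, Matrix.cons_val_zero, Matrix.cons_val_one, add_right_inj] at h0 h1
  rw [mul_left_cancel₀ this h0, mul_left_cancel₀ this h1]

theorem numer_eq_zero_iff (hN : 0 < N) (A B : ℤ) (x : ℤ × ℤ) :
    numer N A B x = 0 ↔ pt N A x.1 = 0 ∧ pt N B x.2 = 0 := by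
  rw [pt_eq_zero_iff hN, pt_eq_zero_iff hN]
  constructor
  · intro h
    exact ⟨by simpa [numer] using congrFun h 0, by simpa [numer] using congrFun h 1⟩
  · rintro ⟨h0, h1⟩
    ext i
    fin_cases i
    · simpa [numer] using h0
    · simpa [numer] using h1

theorem div_le_abs_pt (hN : 0 < N) {A p : ℤ} (h : pt N A p ≠ 0) : 1 / N ≤ |pt N A p| := by
  have h' := (pt_eq_zero_iff hN A p).not.1 h
  rw [pt_eq_div hN, abs_div, Nat.abs_cast]
  gcongr
  exact_mod_cast Int.one_le_abs h'

theorem mul_norm_numer_le (z : ℍ) (hN : 0 < N) (A B : ℤ) (x : ℤ × ℤ) :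
    EisensteinSeries.r z / N * ‖numer N A B x‖ ≤ ‖(pt N A x.1 : ℂ) * z + pt N B x.2‖ := by
  by_cases hx : numer N A B x = 0
  · rw [hx]; simp
  have h := EisensteinSeries.r_mul_max_le z hx
  have hN' : (N : ℂ) ≠ 0 := by exact_mod_cast hN.ne'
  have : (pt N A x.1 : ℂ) * z + pt N B x.2 =
      ((numer N A B x 0 : ℂ) * z + numer N A B x 1) / N := by
    rw [pt_eq_div hN, pt_eq_div hN]
    simp [numer]
    field_simp
  rw [this, norm_div, Complex.norm_natCast, div_mul_eq_mul_div]
  gcongr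

theorem summable_norm_numer (hN : 0 < N) (A B : ℤ) {k : ℝ} (hk : 2 < k) :
    Summable fun x : ℤ × ℤ => ‖numer N A B x‖ ^ (-k) :=
  (EisensteinSeries.summable_one_div_norm_rpow hk).comp_injective (numer_injective hN A B)

/-- A bound by which the lattice vectors dominate their numerators. -/
theorem exists_norm_numer_bound (z : ℍ) (hN : 0 < N) (A B : ℤ) :
    ∃ c : ℝ, 0 < c ∧ c ≤ 1 ∧ ∀ x : ℤ × ℤ,
      c * ‖numer N A B x‖ ≤ ‖(pt N A x.1 : ℂ) * z + pt N B x.2‖ ∧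
      (pt N A x.1 ≠ 0 → ∀ t ∈ Set.Icc (0 : ℝ) 1,
        c * ‖numer N A B x‖ ≤ ‖(pt N A x.1 : ℂ) * z + ((pt N B x.2 + t : ℝ) : ℂ)‖) := by
  have hr := EisensteinSeries.r_pos z
  have hy := z.im_pos
  have hNR : (0 : ℝ) < N := by exact_mod_cast hN
  -- In a row `u ≠ 0` one has `|u| ≥ 1/N`, so every `w` on it satisfies `|w| ≥ Im z/N`. Shifting `w`
  -- by at most `1` therefore enlarges its norm by at most the factor `κ`.
  set κ : ℝ := 1 + N / z.im with hκ
  have hκ1 : 1 ≤ κ := le_add_of_nonneg_right (by positivity)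
  refine ⟨min 1 (EisensteinSeries.r z / N / κ), by positivity, min_le_left _ _, fun x => ?_⟩
  have h0 := mul_norm_numer_le z hN A B x
  have hc : min 1 (EisensteinSeries.r z / N / κ) * ‖numer N A B x‖ ≤
      ‖(pt N A x.1 : ℂ) * z + pt N B x.2‖ / κ := by
    rw [le_div_iff₀ (by positivity)]
    calc _ ≤ (EisensteinSeries.r z / N / κ) * ‖numer N A B x‖ * κ := by
          gcongr; exact min_le_right _ _
      _ = EisensteinSeries.r z / N * ‖numer N A B x‖ := by field_simp
      _ ≤ _ := h0
  refine ⟨hc.trans (div_le_self (norm_nonneg _) hκ1), fun hu t ht => hc.trans ?_⟩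
  rw [div_le_iff₀ (by positivity)]
  set w := (pt N A x.1 : ℂ) * z + ((pt N B x.2 + t : ℝ) : ℂ) with hw
  have h1 : ‖(pt N A x.1 : ℂ) * z + pt N B x.2‖ ≤ ‖w‖ + 1 := by
    have : (pt N A x.1 : ℂ) * z + pt N B x.2 = w - (t : ℂ) := by rw [hw]; push_cast; ring
    rw [this]
    refine (norm_sub_le _ _).trans ?_
    rw [Complex.norm_real, Real.norm_eq_abs, abs_of_nonneg ht.1]
    linarith [ht.2]
  have h2 : z.im / N ≤ ‖w‖ := by
    have h3 := Complex.abs_im_le_norm w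
    have h4 : w.im = pt N A x.1 * z.im := by simp [hw]
    rw [h4, abs_mul, abs_of_pos hy] at h3
    refine le_trans ?_ h3
    have := mul_le_mul_of_nonneg_right (div_le_abs_pt hN hu) hy.le
    calc z.im / N = 1 / N * z.im := by ring
      _ ≤ _ := this
  have h5 : 1 ≤ ‖w‖ * (N / z.im) := by
    calc (1 : ℝ) = z.im / N * (N / z.im) := by field_simp
      _ ≤ _ := by gcongr
  rw [hκ, mul_add, mul_one]
  linarith

theorem summable_kern (z : ℍ) (hN : 0 < N) (A B : ℤ) {s : ℂ} (hs : 0 < s.re) :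
    Summable fun x : ℤ × ℤ => kern z s (pt N A x.1) (pt N B x.2) := by
  obtain ⟨c, hc, hc1, h⟩ := exists_norm_numer_bound z hN A B
  refine Summable.of_norm_bounded ((summable_norm_numer hN A B (k := 2 + s.re)
    (by linarith)).mul_left (c ^ (-(2 + s.re)))) fun x => ?_
  by_cases hx : numer N A B x = 0
  · obtain ⟨h0, h1⟩ := (numer_eq_zero_iff hN A B x).1 hx
    rw [h0, h1, kern_zero_zero, norm_zero]
    positivity
  · have hx' : pt N A x.1 ≠ 0 ∨ pt N B x.2 ≠ 0 := by
      rw [numer_eq_zero_iff hN] at hx; tauto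
    rw [norm_kern hx']
    exact rpow_neg_le_of_le hc hc1 (one_le_norm_int_vec hx) (h x).1 le_rfl (by linarith) le_rfl

/-- The part of the general term that remains after subtracting its mean over a unit interval. -/
def diffTerm (z : ℍ) (N : ℕ) (A B : ℤ) (s : ℂ) (x : ℤ × ℤ) : ℂ :=
  kern z s (pt N A x.1) (pt N B x.2) -
    if pt N A x.1 = 0 then 0 else ∫ t in (0 : ℝ)..1, kern z s (pt N A x.1) (pt N B x.2 + t)

theorem norm_kern_sub_integral_le (z : ℍ) (s : ℂ) {u : ℝ} (hu : u ≠ 0) (v : ℝ) {M : ℝ}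
    (hM : ∀ t ∈ Set.Icc (0 : ℝ) 1, ‖(u : ℂ) * z + ((v + t : ℝ) : ℂ)‖ ^ (-(3 + s.re)) ≤ M) :
    ‖kern z s u v - ∫ t in (0 : ℝ)..1, kern z s u (v + t)‖ ≤ (2 + ‖s‖) * M := by
  have hi : IntervalIntegrable (fun t => kern z s u (v + t)) volume 0 1 :=
    ((continuous_kern z s hu).comp (continuous_const.add continuous_id)).intervalIntegrable _ _
  have h1 : kern z s u v - ∫ t in (0 : ℝ)..1, kern z s u (v + t) =
      ∫ t in (0 : ℝ)..1, (kern z s u v - kern z s u (v + t)) := by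
    rw [intervalIntegral.integral_sub (by simp) hi]
    simp
  choose d hd hdb using fun t => exists_hasDerivAt_kern z s hu t
  rw [h1]
  have := intervalIntegral.norm_integral_le_of_norm_le_const (a := (0 : ℝ)) (b := 1)
    (f := fun t => kern z s u v - kern z s u (v + t)) (C := (2 + ‖s‖) * M) ?_
  · simpa using this
  intro t ht
  rw [Set.uIoc_of_le zero_le_one] at ht
  have hder : ∀ x ∈ Set.Icc (0 : ℝ) 1, HasDerivWithinAt (fun t => kern z s u (v + t)) (d (v + x))
      (Set.Icc 0 1) x := fun x _ => ((hd (v + x)).comp_const_add v x).hasDerivWithinAt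
  have hb : ∀ x ∈ Set.Icc (0 : ℝ) 1, ‖d (v + x)‖ ≤ (2 + ‖s‖) * M := fun x hx =>
    (hdb (v + x)).trans (by gcongr; exact hM x hx)
  have hmv := (convex_Icc (0 : ℝ) 1).norm_image_sub_le_of_norm_hasDerivWithin_le hder hb
    (Set.left_mem_Icc.2 zero_le_one) (Set.Ioc_subset_Icc_self ht)
  rw [norm_sub_rev]
  simp only [add_zero, sub_zero, Real.norm_eq_abs, abs_of_pos ht.1] at hmv
  refine hmv.trans (mul_le_of_le_one_right ?_ ht.2)
  exact (norm_nonneg _).trans (hb 0 (Set.left_mem_Icc.2 zero_le_one))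

/-- At most one `p` makes the first coordinate vanish, so this is a one-dimensional sum with
exponent `3/2 > 1`. -/
theorem summable_row_zero (hN : 0 < N) (A B : ℤ) : Summable fun x : ℤ × ℤ =>
    if pt N A x.1 = 0 then |((B + N * x.2 : ℤ) : ℝ)| ^ (-(3 / 2 : ℝ)) else 0 := by
  by_cases hp : ∃ p, pt N A p = 0
  · obtain ⟨p, hp⟩ := hp
    have hinj : Function.Injective fun q : ℤ => (p, q) := Prod.mk_right_injective p
    rw [← hinj.summable_iff]
    · have hN' : (N : ℤ) ≠ 0 := by exact_mod_cast hN.ne'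
      have hinj2 : Function.Injective fun q : ℤ => B + N * q := fun q q' h =>
        mul_left_cancel₀ hN' (add_left_cancel h)
      have h := (Real.summable_abs_int_rpow (b := 3 / 2) (by norm_num)).comp_injective hinj2
      refine h.congr fun q => ?_
      simp [hp]
    · rintro ⟨p', q⟩ hx
      refine if_neg fun h => hx ⟨q, ?_⟩
      rw [pt_injective N A (hp.trans h.symm)]
  · push Not at hp
    simp [hp]

/-- For `Re s > -1/2` the exponent is `2 + Re s > 3/2` on the row through zero, where nothing is
subtracted, and `3 + Re s > 5/2` on the other rows by the mean value inequality. These exceed `1`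
and `2`, the thresholds in dimensions one and two. -/
theorem exists_diffTerm_bound (z : ℍ) (hN : 0 < N) (A B : ℤ) (R : ℝ) :
    ∃ b : ℤ × ℤ → ℝ, Summable b ∧ ∀ (x : ℤ × ℤ) (s : ℂ), -(1 / 2) < s.re → ‖s‖ < R →
      ‖diffTerm z N A B s x‖ ≤ b x := by
  obtain ⟨c, hc, hc1, h⟩ := exists_norm_numer_bound z hN A B
  have hNR : (0 : ℝ) < N := by exact_mod_cast hN
  refine ⟨fun x => (1 / N : ℝ) ^ (-(2 + R)) *
      (if pt N A x.1 = 0 then |((B + N * x.2 : ℤ) : ℝ)| ^ (-(3 / 2 : ℝ)) else 0) +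
      (2 + R) * (c ^ (-(3 + R)) * ‖numer N A B x‖ ^ (-(5 / 2) : ℝ)),
    ((summable_row_zero hN A B).mul_left _).add
      (((summable_norm_numer hN A B (k := 5 / 2) (by norm_num)).mul_left _).mul_left _),
    fun x s hs hR => ?_⟩
  have hR0 : 0 ≤ R := (norm_nonneg s).trans hR.le
  have hsR : s.re ≤ R := (Complex.re_le_norm s).trans hR.le
  beta_reduce
  by_cases hu : pt N A x.1 = 0
  · rw [diffTerm, if_pos hu, if_pos hu, sub_zero, hu]
    refine le_add_of_le_of_nonneg ?_ (by positivity)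
    by_cases hv : pt N B x.2 = 0
    · rw [hv, kern_zero_zero, norm_zero]; positivity
    · rw [norm_kern (Or.inr hv)]
      have hv' := (pt_eq_zero_iff hN B x.2).not.1 hv
      refine rpow_neg_le_of_le (by positivity) ?_ ?_ ?_ (by linarith) (by linarith) (by linarith)
      · rw [div_le_one hNR]; exact_mod_cast hN
      · exact_mod_cast Int.one_le_abs hv'
      · rw [pt_eq_div hN]
        simp only [Complex.ofReal_zero, zero_mul, zero_add, Complex.norm_real, Real.norm_eq_abs,
          abs_div, Nat.abs_cast]
        exact le_of_eq (by ring)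
  · rw [diffTerm, if_neg hu, if_neg hu]
    refine le_add_of_nonneg_of_le (by simp) ?_
    have hx : numer N A B x ≠ 0 := fun hx => hu ((numer_eq_zero_iff hN A B x).1 hx).1
    refine (norm_kern_sub_integral_le z s hu _ (fun t ht => rpow_neg_le_of_le hc hc1
      (one_le_norm_int_vec hx) ((h x).2 hu t ht) (k₀ := 5 / 2) (k₁ := 3 + R) (by linarith)
      (by linarith) (by linarith))).trans ?_
    gcongr

theorem summable_diffTerm (z : ℍ) (hN : 0 < N) (A B : ℤ) {s : ℂ} (hs : -(1 / 2) < s.re) :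
    Summable (diffTerm z N A B s) := by
  obtain ⟨b, hb, h⟩ := exists_diffTerm_bound z hN A B (‖s‖ + 1)
  exact Summable.of_norm_bounded hb fun x => h x s hs (by linarith)

theorem differentiable_kern_left (z : ℍ) (u v : ℝ) : Differentiable ℂ fun s => kern z s u v := by
  by_cases h : u ≠ 0 ∨ v ≠ 0
  · simp_rw [kern, ofReal_norm_cpow (linear_ne_zero_of_ne z h)]
    fun_prop
  · push Not at h
    simp [h.1, h.2]

theorem differentiable_diffTerm (z : ℍ) (N : ℕ) (A B : ℤ) (x : ℤ × ℤ) :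
    Differentiable ℂ fun s => diffTerm z N A B s x := by
  unfold diffTerm
  refine (differentiable_kern_left z _ _).sub ?_
  split_ifs with hu
  · exact differentiable_const _
  · exact differentiable_intervalIntegral_kern z hu _

theorem differentiableOn_tsum_diffTerm (z : ℍ) (hN : 0 < N) (A B : ℤ) :
    DifferentiableOn ℂ (fun s => ∑' x, diffTerm z N A B s x) {s | -(1 / 2) < s.re} := by
  intro s hs
  obtain ⟨b, hb, h⟩ := exists_diffTerm_bound z hN A B (‖s‖ + 1)
  have ho : IsOpen {s : ℂ | -(1 / 2) < s.re} := isOpen_lt continuous_const Complex.continuous_re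
  have ho' : IsOpen {w : ℂ | ‖w‖ < ‖s‖ + 1} := isOpen_lt continuous_norm continuous_const
  have := Complex.differentiableOn_tsum_of_summable_norm hb
    (fun x => (differentiable_diffTerm z N A B x).differentiableOn) (ho.inter ho')
    (fun x w hw => h x w hw.1 hw.2)
  exact (this.differentiableAt ((ho.inter ho').mem_nhds
    ⟨hs, by simp⟩)).differentiableWithinAt

end

/-! ### The analytic continuation and its value at `s = 0`. -/

section

open MeasureTheory Filter Topology HurwitzZeta

variable {N : ℕ} {A B : ℤ}

/-- The entire function `s ↦ s ζ(1 + s)`, for the even Hurwitz zeta function. -/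
def mulZeta (a : UnitAddCircle) (s : ℂ) : ℂ :=
  -- The bare product with `s` would take the value `0` at `s = 0`. Splitting off the polar part and
  -- adding back `s` times it gives the limit `1` there.
  s * (hurwitzZetaEven a (1 + s) - 1 / s / Complex.Gammaℝ (1 + s)) + (Complex.Gammaℝ (1 + s))⁻¹

theorem mulZeta_of_ne {a : UnitAddCircle} {s : ℂ} (hs : s ≠ 0) :
    mulZeta a s = s * hurwitzZetaEven a (1 + s) := by
  rw [mulZeta]; field_simp; ring

theorem mulZeta_zero (a : UnitAddCircle) : mulZeta a 0 = 1 := by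
  simp [mulZeta, Complex.Gammaℝ_one]

theorem differentiable_mulZeta (a : UnitAddCircle) : Differentiable ℂ (mulZeta a) := by
  intro s
  have hG : DifferentiableAt ℂ (fun s => (Complex.Gammaℝ (1 + s))⁻¹) s :=
    (Complex.differentiable_Gammaℝ_inv (1 + s)).comp s (by fun_prop : DifferentiableAt ℂ
      (fun s : ℂ => 1 + s) s)
  refine DifferentiableAt.add (differentiableAt_id.mul ?_) hG
  by_cases hs : s = 0
  · subst hs
    have h := differentiableAt_hurwitzZetaEven_sub_one_div a
    rw [← add_zero (1 : ℂ)] at h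
    have := h.comp (0 : ℂ) (by fun_prop : DifferentiableAt ℂ (fun s : ℂ => 1 + s) 0)
    refine this.congr_of_eventuallyEq (Eventually.of_forall fun s => ?_)
    simp
  · have h1 : DifferentiableAt ℂ (fun s => hurwitzZetaEven a (1 + s)) s :=
      (differentiableAt_hurwitzZetaEven a (by simpa using hs)).comp s
        (by fun_prop : DifferentiableAt ℂ (fun s : ℂ => 1 + s) s)
    refine h1.sub ?_
    have h2 : DifferentiableAt ℂ (fun s : ℂ => 1 / s) s := by fun_prop (disch := assumption)
    refine (h2.mul hG).congr_of_eventuallyEq (Eventually.of_forall fun s => ?_)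
    simp [div_eq_mul_inv]

theorem hasSum_row_integral (z : ℍ) {s : ℂ} (hs : -1 < s.re) {u : ℝ} (hu : u ≠ 0) (N : ℕ) (B : ℤ) :
    HasSum (fun q : ℤ => ∫ t in (0 : ℝ)..1, kern z s u (pt N B q + t)) (∫ t, kern z s u t) := by
  have h := ((integrable_kern z hs hu).comp_add_right
    ((B : ℝ) / N)).hasSum_intervalIntegral_comp_add_int
  rw [integral_add_right_eq_self (kern z s u)] at h
  refine h.congr_fun fun q => ?_
  congr 1
  funext t
  congr 1
  rw [pt]; ring

/-- The sum of the integrals over all rows. -/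
def integralPart (z : ℍ) (N : ℕ) (A : ℤ) (s : ℂ) : ℂ :=
  -- The `2` in the numerator appears because `hurwitzZetaEven` is half of the sum over all of `ℤ`;
  -- the factor `s` of `integral_kern` has moved into `mulZeta`.
  -(2 / (2 + s)) * ((z.im : ℂ) ^ (-1 - s) * rowIntegral s) *
    mulZeta (((A : ℝ) / N : ℝ) : UnitAddCircle) s

/-- The analytic continuation of the Eisenstein series of weight 2. -/
def continuation (z : ℍ) (N : ℕ) (A B : ℤ) (s : ℂ) : ℂ :=
  (∑' x, diffTerm z N A B s x) + integralPart z N A s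

theorem differentiableOn_integralPart (z : ℍ) (N : ℕ) (A : ℤ) :
    DifferentiableOn ℂ (integralPart z N A) {s | -(1 / 2) < s.re} := by
  have h1 : ∀ s ∈ {s : ℂ | -(1 / 2) < s.re}, 2 + s ≠ 0 := by
    intro s hs h
    have := congrArg Complex.re h
    simp at this hs
    linarith
  have hy : (z.im : ℂ) ≠ 0 := by exact_mod_cast z.im_ne_zero
  have h2 : DifferentiableOn ℂ rowIntegral {s | -(1 / 2) < s.re} :=
    differentiableOn_rowIntegral.mono fun s hs => by
      have : -(1 / 2) < s.re := hs
      change -1 < s.re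
      linarith
  have h3 : Differentiable ℂ fun s : ℂ => (z.im : ℂ) ^ (-1 - s) := fun s =>
    DifferentiableAt.const_cpow (f := fun s : ℂ => -1 - s) (by fun_prop) (Or.inl hy)
  refine DifferentiableOn.mul (DifferentiableOn.mul (DifferentiableOn.neg ?_)
    (h3.differentiableOn.mul h2)) (differentiable_mulZeta _).differentiableOn
  exact DifferentiableOn.div (by fun_prop) (by fun_prop) h1

theorem hasSum_continuation (z : ℍ) (hN : 0 < N) (A B : ℤ) {s : ℂ} (hs : 0 < s.re) :
    HasSum (fun x : ℤ × ℤ => kern z s (pt N A x.1) (pt N B x.2)) (continuation z N A B s) := by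
  have hd := summable_diffTerm z hN A B (s := s) (by linarith)
  have he := (summable_kern z hN A B hs).sub hd
  have hsne : s ≠ 0 := fun h => by simp [h] at hs
  have hs1 : 1 + s ≠ 0 := fun h => by
    have := congrArg Complex.re h
    simp at this; linarith
  have hy : (z.im : ℂ) ≠ 0 := by exact_mod_cast z.im_ne_zero
  have hfib : ∀ p : ℤ, HasSum (fun q : ℤ => kern z s (pt N A p) (pt N B q) -
      diffTerm z N A B s (p, q)) (-(s / (2 + s)) * ((z.im : ℂ) ^ (-1 - s) * rowIntegral s) * 2 *
        (1 / (↑|(p : ℝ) + (A : ℝ) / N| : ℂ) ^ (1 + s) / 2)) := by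
    intro p
    have hpt : (p : ℝ) + (A : ℝ) / N = pt N A p := by rw [pt]; ring
    simp only [diffTerm, sub_sub_cancel, hpt]
    by_cases hu : pt N A p = 0
    -- On the row through zero nothing was subtracted, and the zeta term is also `0`, because `0 ^
    -- (1 + s) = 0` and `1 / 0 = 0`.
    · simp [hu, hs1, hasSum_zero]
    · simp only [if_neg hu]
      have h := hasSum_row_integral z (s := s) (by linarith) hu N B
      rw [integral_kern z (by linarith) hu] at h
      convert h using 1
      rw [Complex.ofReal_mul, Complex.mul_cpow_ofReal_nonneg (abs_nonneg _) z.im_pos.le,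
        show -1 - s = -(1 + s) by ring, Complex.cpow_neg ((|pt N A p| : ℝ) : ℂ)]
      ring
  have h1 := he.hasSum.prod_fiberwise hfib
  have h2 := (hasSum_int_hurwitzZetaEven ((A : ℝ) / N) (s := 1 + s)
    (by simpa using hs)).mul_left (-(s / (2 + s)) * ((z.im : ℂ) ^ (-1 - s) * rowIntegral s) * 2)
  have h3 : ∑' x : ℤ × ℤ, (kern z s (pt N A x.1) (pt N B x.2) - diffTerm z N A B s x) =
      integralPart z N A s := by
    rw [h1.unique h2, integralPart, mulZeta_of_ne hsne]
    ring
  have h4 := hd.hasSum.add he.hasSum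
  rw [h3] at h4
  rw [continuation]
  simpa using h4

theorem coe_eq_coe_iff_exists (q r : ℚ) :
    (q : AddCircle (1 : ℚ)) = r ↔ ∃ n : ℤ, q = r + n := by
  rw [QuotientAddGroup.eq_iff_sub_mem, AddSubgroup.mem_zmultiples_iff]
  constructor
  · rintro ⟨n, hn⟩
    exact ⟨n, by simp at hn; linarith⟩
  · rintro ⟨n, hn⟩
    exact ⟨n, by simp [hn]⟩

/-- The point `(A / N, B / N)` of `(ℚ/ℤ)²`. -/
def ratPoint (N : ℕ) (A B : ℤ) : S :=
  ![(((A : ℚ) / N : ℚ) : AddCircle (1 : ℚ)), (((B : ℚ) / N : ℚ) : AddCircle (1 : ℚ))]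

theorem exists_eq_ratPoint (a : S) : ∃ (N : ℕ) (A B : ℤ), 0 < N ∧ a = ratPoint N A B := by
  obtain ⟨q, hq⟩ := QuotientAddGroup.mk_surjective (a 0)
  obtain ⟨r, hr⟩ := QuotientAddGroup.mk_surjective (a 1)
  refine ⟨q.den * r.den, q.num * r.den, r.num * q.den, Nat.mul_pos q.pos r.pos, ?_⟩
  have hq0 : (q.den : ℚ) ≠ 0 := by exact_mod_cast q.den_ne_zero
  have hr0 : (r.den : ℚ) ≠ 0 := by exact_mod_cast r.den_ne_zero
  have h1 : ((q.num * r.den : ℤ) : ℚ) / ((q.den * r.den : ℕ) : ℚ) = q := by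
    push_cast
    rw [mul_div_mul_right _ _ hr0, Rat.num_div_den]
  have h2 : ((r.num * q.den : ℤ) : ℚ) / ((q.den * r.den : ℕ) : ℚ) = r := by
    push_cast
    rw [mul_comm (q.den : ℚ), mul_div_mul_right _ _ hq0, Rat.num_div_den]
  ext i
  fin_cases i
  · simp only [ratPoint, h1]; exact hq.symm
  · simp only [ratPoint, h2]; exact hr.symm

/-- The point `(A / N + p, B / N + q)` of `ℚ²`. -/
def latticePt (N : ℕ) (A B : ℤ) (x : ℤ × ℤ) : Fin 2 → ℚ :=
  ![(A : ℚ) / N + x.1, (B : ℚ) / N + x.2]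

theorem latticePt_injective (N : ℕ) (A B : ℤ) : Function.Injective (latticePt N A B) := by
  rintro ⟨p, q⟩ ⟨p', q'⟩ h
  have h0 : (A : ℚ) / N + p = (A : ℚ) / N + p' := congrFun h 0
  have h1 : (B : ℚ) / N + q = (B : ℚ) / N + q' := congrFun h 1
  rw [Int.cast_injective (add_left_cancel h0), Int.cast_injective (add_left_cancel h1)]

theorem term_latticePt (z : ℍ) (s : ℂ) (N : ℕ) (A B : ℤ) (x : ℤ × ℤ) :
    term z s (latticePt N A B x) = kern z s (pt N A x.1) (pt N B x.2) := by
  simp [term_eq_kern, latticePt, pt]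

theorem coset_ratPoint (N : ℕ) (A B : ℤ) :
    coset (ratPoint N A B) = Set.range (latticePt N A B) \ {0} := by
  ext m
  have h0 : ratPoint N A B 0 = (((A : ℚ) / N : ℚ) : AddCircle (1 : ℚ)) := rfl
  have h1 : ratPoint N A B 1 = (((B : ℚ) / N : ℚ) : AddCircle (1 : ℚ)) := rfl
  constructor
  · rintro ⟨hm, h⟩
    obtain ⟨p, hp⟩ := (coe_eq_coe_iff_exists _ _).1 ((h 0).trans h0)
    obtain ⟨q, hq⟩ := (coe_eq_coe_iff_exists _ _).1 ((h 1).trans h1)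
    refine ⟨⟨(p, q), ?_⟩, hm⟩
    ext i
    fin_cases i
    · exact hp.symm
    · exact hq.symm
  · rintro ⟨⟨⟨p, q⟩, rfl⟩, hm⟩
    refine ⟨hm, fun i => ?_⟩
    fin_cases i
    · exact (coe_eq_coe_iff_exists _ _).2 ⟨p, rfl⟩
    · exact (coe_eq_coe_iff_exists _ _).2 ⟨q, rfl⟩

/-- The origin may be kept in the index set, since `term` takes the value `0` there by the
convention `0⁻¹ = 0`. -/
theorem hasSum_coset_iff (z : ℍ) (s : ℂ) (N : ℕ) (A B : ℤ) (F : ℂ) :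
    HasSum (fun m : coset (ratPoint N A B) => term z s m) F ↔
      HasSum (fun x : ℤ × ℤ => kern z s (pt N A x.1) (pt N B x.2)) F := by
  have h1 := (latticePt_injective N A B).hasSum_range_iff (f := term z s) (a := F)
  have h2 := hasSum_subtype_iff_indicator (f := term z s) (a := F)
    (s := coset (ratPoint N A B))
  have h3 := hasSum_subtype_iff_indicator (f := term z s) (a := F)
    (s := Set.range (latticePt N A B))
  have : Set.indicator (coset (ratPoint N A B)) (term z s) =
      Set.indicator (Set.range (latticePt N A B)) (term z s) := by
    rw [coset_ratPoint]
    funext m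
    by_cases hm : m = 0
    · have : term z s m = 0 := by simp [hm, term_eq_kern]
      rw [Set.indicator_apply_eq_zero.2 fun _ => this, Set.indicator_apply_eq_zero.2 fun _ => this]
    · by_cases hr : m ∈ Set.range (latticePt N A B)
      · have hm' : m ∈ Set.range (latticePt N A B) \ {0} := ⟨hr, hm⟩
        rw [Set.indicator_of_mem hm', Set.indicator_of_mem hr]
      · have hm' : m ∉ Set.range (latticePt N A B) \ {0} := fun h => hr h.1
        rw [Set.indicator_of_notMem hm', Set.indicator_of_notMem hr]
  rw [this] at h2
  have h4 : (fun x : ℤ × ℤ => kern z s (pt N A x.1) (pt N B x.2)) =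
      term z s ∘ latticePt N A B := funext fun x => (term_latticePt z s N A B x).symm
  rw [h4]
  exact (h2.trans h3.symm).trans h1

theorem isContinuation_continuation (z : ℍ) (hN : 0 < N) (A B : ℤ) :
    IsContinuation (ratPoint N A B) z (continuation z N A B) := by
  refine ⟨{s | -(1 / 2) < s.re}, isOpen_lt continuous_const Complex.continuous_re,
    (convex_halfSpace_re_gt _).isPreconnected, fun s hs => ?_, by simp,
    (differentiableOn_tsum_diffTerm z hN A B).add (differentiableOn_integralPart z N A),
    fun s hs => (hasSum_coset_iff z s N A B _).2 (hasSum_continuation z hN A B hs)⟩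
  have : 0 < s.re := hs
  change -(1 / 2) < s.re
  linarith

theorem exists_isContinuation (a : S) (z : ℍ) : ∃ F : ℂ → ℂ, IsContinuation a z F := by
  obtain ⟨N, A, B, hN, rfl⟩ := exists_eq_ratPoint a
  exact ⟨_, isContinuation_continuation z hN A B⟩

theorem IsContinuation.G_eq {a : S} {z : ℍ} {F : ℂ → ℂ} (h : IsContinuation a z F) :
    G a z = F 0 := by
  have h' : ∃ F : ℂ → ℂ, IsContinuation a z F := ⟨F, h⟩
  rw [G, dif_pos h']
  exact h'.choose_spec.value_unique h

theorem integralPart_zero (z : ℍ) (N : ℕ) (A : ℤ) : integralPart z N A 0 = -(Real.pi / z.im) := by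
  have hy : (z.im : ℂ) ≠ 0 := by exact_mod_cast z.im_ne_zero
  rw [integralPart, rowIntegral_zero, mulZeta_zero, sub_zero, Complex.cpow_neg_one]
  field_simp
  ring

/-- At `s = 0` the row integrals vanish, so removing the means leaves each row sum unchanged. The
double family is now absolutely summable, and summing it by rows gives Eisenstein's order of
summation, which defines `G2`. -/
theorem tsum_diffTerm_zero (z : ℍ) :
    ∑' x, diffTerm z 1 0 0 0 x = EisensteinSeries.G2 z := by
  have hd := summable_diffTerm z one_pos 0 0 (s := 0) (by simp)
  have hk : ∀ p q : ℤ, kern z 0 (pt 1 0 p) (pt 1 0 q) =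
      EisensteinSeries.eisSummand 2 ![p, q] z := by
    intro p q
    simp [kern, pt, EisensteinSeries.eisSummand]
  have hfib : ∀ p : ℤ, HasSum (fun q : ℤ => diffTerm z 1 0 0 0 (p, q))
      (EisensteinSeries.e2Summand p z) := by
    intro p
    have h1 := (EisensteinSeries.e2Summand_summable p z).hasSum
    simp only [diffTerm, hk, EisensteinSeries.e2Summand]
    by_cases hu : pt 1 0 p = 0
    · simpa [hu] using h1
    · simp only [if_neg hu]
      have h2 := hasSum_row_integral z (s := 0) (by simp) hu 1 0
      rw [integral_kern z (by simp) hu] at h2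
      simpa using h1.sub h2
  have h := hd.hasSum.prod_fiberwise hfib
  rw [← h.tsum_eq, EisensteinSeries.G2,
    tsum_eq_of_summable_unconditional (L := SummationFilter.symmetricIcc ℤ) h.summable]

theorem G_zero_eq (z : ℍ) : G 0 z = EisensteinSeries.G2 z - Real.pi / z.im := by
  have h0 : (0 : S) = ratPoint 1 0 0 := by
    ext i
    fin_cases i <;> simp [ratPoint]
  rw [h0, (isContinuation_continuation z one_pos 0 0).G_eq, continuation, tsum_diffTerm_zero,
    integralPart_zero]
  ring

end

/-! ### The logarithmic derivative of `Δ` and the formula for `μ_γ`. -/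

section

open Filter Topology ModularForm EisensteinSeries

theorem toReal_det_pos (γ : GL(2, ℚ)⁺) : 0 < (toReal γ).det.val := by
  have h : 0 < (γ : GL (Fin 2) ℚ).det.val := γ.2
  have h2 : (toReal γ).det.val = (((γ : GL (Fin 2) ℚ).det.val : ℚ) : ℝ) := by
    simp [toReal, Matrix.GeneralLinearGroup.map_det]
  rw [h2]
  exact_mod_cast h

theorem phiZero_eq (z : ℍ) : phiZero z = E2 z / 12 - 1 / (4 * Real.pi * z.im) := by
  have hpi : (Real.pi : ℂ) ≠ 0 := by exact_mod_cast Real.pi_ne_zero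
  have hy : (z.im : ℂ) ≠ 0 := by exact_mod_cast z.im_ne_zero
  have hG : G2 z = (Real.pi : ℂ) ^ 2 / 3 * E2 z := by
    simp [E2, riemannZeta_two]
    field_simp
    ring
  rw [phiZero, G_zero_eq, hG]
  field_simp
  ring

theorem hasDerivAt_moebius {g : GL (Fin 2) ℝ} (z : ℍ) :
    HasDerivAt (fun w : ℂ => num g w / denom g w) (g.det.val / denom g z ^ 2) z := by
  have h1 : HasDerivAt (fun w : ℂ => num g w) (g 0 0) z := by
    simpa [num] using ((hasDerivAt_id (z : ℂ)).const_mul (g 0 0 : ℂ)).add_const (g 0 1 : ℂ)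
  have h2 : HasDerivAt (fun w : ℂ => denom g w) (g 1 0) z := by
    simpa [denom] using ((hasDerivAt_id (z : ℂ)).const_mul (g 1 0 : ℂ)).add_const (g 1 1 : ℂ)
  refine (h1.div h2 (denom_ne_zero g z)).congr_deriv ?_
  congr 1
  rw [Matrix.GeneralLinearGroup.val_det_apply, Matrix.det_fin_two]
  simp only [num, denom]
  push_cast
  ring

theorem logDeriv_slash_Delta_div_Delta (γ : GL(2, ℚ)⁺) (z : ℍ) :
    logDeriv (fun w : ℂ => slash 12 Delta γ (ofComplex w) / Delta (ofComplex w)) z =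
      2 * Real.pi * Complex.I * E2 (toReal γ • z) * ((toReal γ).det.val / denom (toReal γ) z ^ 2) -
      12 * ((toReal γ 1 0 : ℝ) / denom (toReal γ) z) - 2 * Real.pi * Complex.I * E2 z := by
  have hdet := toReal_det_pos γ
  set g := toReal γ with hg
  have hpi : (2 * (Real.pi : ℂ)) ^ 12 ≠ 0 := by
    have : (Real.pi : ℂ) ≠ 0 := by exact_mod_cast Real.pi_ne_zero
    exact pow_ne_zero _ (mul_ne_zero two_ne_zero this)
  set K : ℂ := ((g.det.val ^ (((12 : ℕ) : ℝ) / 2) : ℝ) : ℂ) with hK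
  have hK0 : K ≠ 0 := by
    rw [hK]; exact_mod_cast (Real.rpow_pos_of_pos hdet _).ne'
  have hev : (fun w : ℂ => slash 12 Delta γ (ofComplex w) / Delta (ofComplex w)) =ᶠ[𝓝 (z : ℂ)]
      fun w => K * (eta (num g w / denom g w) ^ 24 / (denom g w ^ 12 * eta w ^ 24)) := by
    filter_upwards [(isOpen_lt continuous_const Complex.continuous_im).mem_nhds z.im_pos] with w hw
    simp only [slash, ← hg, Delta, coe_smul_of_det_pos hdet, ofComplex_apply_of_im_pos hw]
    rw [← hK]
    field_simp
  have hz : (num g z / denom g z : ℂ) = (g • z : ℍ) := (coe_smul_of_det_pos hdet z).symm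
  have hη : eta (g • z : ℍ) ≠ 0 := eta_ne_zero (g • z : ℍ).2
  have hη' : eta z ≠ 0 := eta_ne_zero z.2
  have hd : denom g z ≠ 0 := denom_ne_zero g z
  have dη : DifferentiableAt ℂ eta (g • z : ℍ) :=
    differentiableAt_eta_of_mem_upperHalfPlaneSet (g • z : ℍ).2
  have dη' : DifferentiableAt ℂ eta z := differentiableAt_eta_of_mem_upperHalfPlaneSet z.2
  have hm := hasDerivAt_moebius (g := g) z
  have dc : DifferentiableAt ℂ (fun w => eta (num g w / denom g w)) z :=
    DifferentiableAt.comp (g := eta) (z : ℂ) (by rw [hz]; exact dη) hm.differentiableAt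
  have hden : HasDerivAt (fun w : ℂ => denom g w) (g 1 0) z := by
    simpa [denom] using ((hasDerivAt_id (z : ℂ)).const_mul (g 1 0 : ℂ)).add_const (g 1 1 : ℂ)
  rw [(logDeriv_congr_nhds hev).eq_of_nhds, logDeriv_const_mul _ _ hK0,
    logDeriv_div (f := fun w => eta (num g w / denom g w) ^ 24)
      (g := fun w => denom g w ^ 12 * eta w ^ 24) (z : ℂ) (by rw [hz]; exact pow_ne_zero _ hη)
      (mul_ne_zero (pow_ne_zero _ hd) (pow_ne_zero _ hη')) (dc.pow 24)
      ((hden.differentiableAt.pow 12).mul (dη'.pow 24)),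
    logDeriv_mul (f := fun w => denom g w ^ 12) (g := fun w => eta w ^ 24) (z : ℂ)
      (pow_ne_zero _ hd) (pow_ne_zero _ hη')
      (hden.differentiableAt.pow 12) (dη'.pow 24),
    logDeriv_fun_pow dc, logDeriv_fun_pow hden.differentiableAt, logDeriv_fun_pow dη',
    logDeriv_eta_eq_E2]
  have h1 : logDeriv (fun w => eta (num g w / denom g w)) z =
      Real.pi * Complex.I / 12 * E2 (g • z) * (g.det.val / denom g z ^ 2) := by
    have := logDeriv_comp (f := eta) (g := fun w => num g w / denom g w) (x := (z : ℂ))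
      (by rw [hz]; exact dη) hm.differentiableAt
    rw [hm.deriv, hz, logDeriv_eta_eq_E2] at this
    exact this
  rw [h1, logDeriv_apply, hden.deriv]
  push_cast
  ring

theorem mu_eq (γ : GL(2, ℚ)⁺) (z : ℍ) :
    mu γ z = 2 * (slash 2 phiZero γ z - phiZero z) := by
  have hdet := toReal_det_pos γ
  rw [mu, logDeriv_slash_Delta_div_Delta, slash, phiZero_eq, phiZero_eq, im_smul_eq_div_normSq,
    abs_of_pos hdet]
  set g := toReal γ with hg
  have hpi : (Real.pi : ℂ) ≠ 0 := by exact_mod_cast Real.pi_ne_zero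
  have hy : (z.im : ℂ) ≠ 0 := by exact_mod_cast z.im_ne_zero
  have hD : (g.det.val : ℂ) ≠ 0 := by exact_mod_cast hdet.ne'
  have hd : denom g z ≠ 0 := denom_ne_zero g z
  have hI := Complex.I_ne_zero
  -- The conjugate of `cz + d` is `(cz + d) - 2ic Im z`. This rewrites `1/Im γz` without conjugates
  -- and produces the term `c/(cz + d)`.
  have hns : ((Complex.normSq (denom g z) : ℝ) : ℂ) =
      denom g z * (denom g z - 2 * Complex.I * (g 1 0 : ℝ) * z.im) := by
    rw [← Complex.mul_conj]
    congr 1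
    apply Complex.ext <;> simp [denom]
    ring
  have hc : denom g z - 2 * Complex.I * (g 1 0 : ℝ) * z.im ≠ 0 := by
    intro h
    rw [h, mul_zero] at hns
    exact (normSq_denom_pos g z.im_ne_zero).ne' (by exact_mod_cast hns)
  have h1 : (((g.det.val : ℝ) ^ (((2 : ℕ) : ℝ) / 2) : ℝ) : ℂ) = g.det.val := by norm_num
  rw [h1]
  push_cast
  rw [hns]
  generalize denom g z = δ at *
  field_simp
  ring_nf
  simp only [Complex.I_sq]
  ring

end

/-! ### The functions `φ_x` as limits of series twisted by characters of `ℤ²`. -/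

section

open Filter Topology

theorem expQ_coe (q : ℚ) : expQ (q : AddCircle (1 : ℚ)) =
    Complex.exp (2 * Real.pi * Complex.I * (q : ℂ)) := expQ_periodic.lift_coe q

theorem expQ_add (a b : AddCircle (1 : ℚ)) : expQ (a + b) = expQ a * expQ b := by
  obtain ⟨q, rfl⟩ := QuotientAddGroup.mk_surjective a
  obtain ⟨r, rfl⟩ := QuotientAddGroup.mk_surjective b
  change expQ ((q + r : ℚ) : AddCircle (1 : ℚ)) = expQ (q : AddCircle (1 : ℚ)) * expQ r
  rw [expQ_coe, expQ_coe, expQ_coe, ← Complex.exp_add]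
  push_cast
  ring_nf

theorem expQ_zero : expQ 0 = 1 := by
  have := expQ_coe 0
  simpa using this

theorem norm_expQ (a : AddCircle (1 : ℚ)) : ‖expQ a‖ = 1 := by
  obtain ⟨q, rfl⟩ := QuotientAddGroup.mk_surjective a
  rw [expQ_coe, Complex.norm_exp]
  simp

theorem expQ_eq_one_iff (a : AddCircle (1 : ℚ)) : expQ a = 1 ↔ a = 0 := by
  refine ⟨fun h => ?_, fun h => by rw [h, expQ_zero]⟩
  obtain ⟨q, rfl⟩ := QuotientAddGroup.mk_surjective a
  change expQ (q : AddCircle (1 : ℚ)) = 1 at h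
  rw [expQ_coe, Complex.exp_eq_one_iff] at h
  obtain ⟨n, hn⟩ := h
  have hpi : (2 * Real.pi * Complex.I : ℂ) ≠ 0 := Complex.two_pi_I_ne_zero
  rw [mul_comm (n : ℂ)] at hn
  have hq : q = n := by exact_mod_cast mul_left_cancel₀ hpi hn
  change (q : AddCircle (1 : ℚ)) = ((0 : ℚ) : AddCircle (1 : ℚ))
  exact (coe_eq_coe_iff_exists _ _).2 ⟨n, by rw [hq, zero_add]⟩

/-- The character `n ↦ e^{2πi (n₂ x₁ - n₁ x₂)}` of `ℤ²`. -/
def latticeChar (x : S) (n : ℤ × ℤ) : ℂ := expQ (n.2 • x 0 - n.1 • x 1)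

/-- The Eisenstein series twisted by a character of `ℤ²`. -/
def twisted (z : ℍ) (x : S) (s : ℂ) : ℂ :=
  ∑' n : ℤ × ℤ, latticeChar x n * kern z s n.1 n.2

theorem summable_kern_int (z : ℍ) {s : ℂ} (hs : 0 < s.re) :
    Summable fun n : ℤ × ℤ => kern z s n.1 n.2 := by
  simpa [pt] using summable_kern z one_pos 0 0 hs

theorem summable_twisted (z : ℍ) (x : S) {s : ℂ} (hs : 0 < s.re) :
    Summable fun n : ℤ × ℤ => latticeChar x n * kern z s n.1 n.2 := by
  refine Summable.of_norm_bounded (summable_kern_int z hs).norm fun n => ?_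
  rw [norm_mul, latticeChar, norm_expQ, one_mul]

theorem kern_div (z : ℍ) (s : ℂ) {N : ℕ} (hN : 0 < N) (u v : ℝ) :
    kern z s (u / N) (v / N) = (N : ℂ) ^ 2 * (N : ℂ) ^ s * kern z s u v := by
  have hN' : (N : ℂ) ≠ 0 := by exact_mod_cast hN.ne'
  have h : ((u / N : ℝ) : ℂ) * z + ((v / N : ℝ) : ℂ) = ((u : ℂ) * z + v) / N := by
    push_cast; field_simp
  rw [kern, kern, h, norm_div, Complex.norm_natCast, div_eq_mul_inv (‖_‖), Complex.ofReal_mul,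
    Complex.mul_cpow_ofReal_nonneg (norm_nonneg _) (by positivity), Complex.ofReal_inv,
    Complex.ofReal_natCast, Complex.inv_cpow_eq_ite, if_neg (by
      rw [Complex.natCast_arg]; exact Real.pi_pos.ne), Complex.cpow_neg (N : ℂ), inv_inv,
    div_pow, inv_div]
  ring

/-- Division with remainder by `N` in both coordinates. -/
def divModMap (N : ℕ) (y : (Fin 2 → Fin N) × (ℤ × ℤ)) : ℤ × ℤ :=
  (((y.1 0 : ℕ) : ℤ) + N * y.2.1, ((y.1 1 : ℕ) : ℤ) + N * y.2.2)

theorem divModMap_bijective {N : ℕ} (hN : 0 < N) : Function.Bijective (divModMap N) := by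
  have hN' : (0 : ℤ) < N := by exact_mod_cast hN
  have key : ∀ (i j : Fin N) (p q : ℤ), ((i : ℕ) : ℤ) + N * p = ((j : ℕ) : ℤ) + N * q →
      i = j ∧ p = q := by
    intro i j p q h
    have h1 : (((i : ℕ) : ℤ) + N * p) % N = (i : ℕ) := by
      rw [Int.add_mul_emod_self_left]
      exact Int.emod_eq_of_lt (by positivity) (by exact_mod_cast i.2)
    have h2 : (((j : ℕ) : ℤ) + N * q) % N = (j : ℕ) := by
      rw [Int.add_mul_emod_self_left]
      exact Int.emod_eq_of_lt (by positivity) (by exact_mod_cast j.2)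
    have hij : i = j := by
      rw [h, h2] at h1
      exact Fin.ext (by exact_mod_cast h1.symm)
    subst hij
    exact ⟨rfl, mul_left_cancel₀ hN'.ne' (add_left_cancel h)⟩
  have surj : ∀ n : ℤ, ∃ (i : Fin N) (p : ℤ), ((i : ℕ) : ℤ) + N * p = n := by
    intro n
    have h0 := Int.emod_nonneg n hN'.ne'
    have h1 := Int.emod_lt_of_pos n hN'
    refine ⟨⟨(n % N).toNat, by lia⟩, n / N, ?_⟩
    simp only [Int.toNat_of_nonneg h0]
    exact Int.emod_add_mul_ediv n N
  constructor
  · rintro ⟨j, p, q⟩ ⟨j', p', q'⟩ h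
    obtain ⟨h0, hp⟩ := key _ _ _ _ (congrArg Prod.fst h)
    obtain ⟨h1, hq⟩ := key _ _ _ _ (congrArg Prod.snd h)
    have hj : j = j' := by
      ext i; fin_cases i
      · exact congrArg Fin.val h0
      · exact congrArg Fin.val h1
    rw [hj, show p = p' from hp, show q = q' from hq]
  · rintro ⟨m, n⟩
    obtain ⟨i, p, hp⟩ := surj m
    obtain ⟨j, q, hq⟩ := surj n
    exact ⟨(![i, j], (p, q)), Prod.ext hp hq⟩

theorem latticeChar_divModMap {N : ℕ} {x : S} (hx : N • x = 0) (j : Fin 2 → Fin N) (n : ℤ × ℤ) :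
    latticeChar x (divModMap N (j, n)) = expQ ((j 1 : ℕ) • x 0 - (j 0 : ℕ) • x 1) := by
  have h0 : N • x 0 = 0 := congrFun hx 0
  have h1 : N • x 1 = 0 := congrFun hx 1
  rw [latticeChar, divModMap]
  congr 1
  simp only [add_smul, natCast_zsmul, mul_comm (N : ℤ), mul_smul, h0, h1, smul_zero, add_zero]

/-- Sort `n ∈ ℤ²` by its residue `j` modulo `N`. The character depends only on `j` because `N • x =
0`, and scaling `n` to `n / N` multiplies the kernel by `N^{2+s}`. -/
theorem twisted_eq_sum (z : ℍ) {N : ℕ} (hN : 0 < N) {x : S} (hx : N • x = 0) {s : ℂ}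
    (hs : 0 < s.re) :
    twisted z x s = ((N : ℂ) ^ 2 * (N : ℂ) ^ s)⁻¹ * ∑ j : Fin 2 → Fin N,
      expQ ((j 1 : ℕ) • x 0 - (j 0 : ℕ) • x 1) *
        continuation z N ((j 0 : ℕ) : ℤ) ((j 1 : ℕ) : ℤ) s := by
  have hN' : (N : ℂ) ≠ 0 := by exact_mod_cast hN.ne'
  have hN2 : (N : ℂ) ^ 2 * (N : ℂ) ^ s ≠ 0 :=
    mul_ne_zero (pow_ne_zero _ hN') (Complex.cpow_ne_zero_iff.2 (Or.inl hN'))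
  let e := Equiv.ofBijective (divModMap N) (divModMap_bijective hN)
  have hsum := e.hasSum_iff.2 (summable_twisted z x hs).hasSum
  have hfib : ∀ j : Fin 2 → Fin N, HasSum (fun n : ℤ × ℤ =>
      ((fun n : ℤ × ℤ => latticeChar x n * kern z s n.1 n.2) ∘ e) (j, n))
      (((N : ℂ) ^ 2 * (N : ℂ) ^ s)⁻¹ * (expQ ((j 1 : ℕ) • x 0 - (j 0 : ℕ) • x 1) *
        continuation z N ((j 0 : ℕ) : ℤ) ((j 1 : ℕ) : ℤ) s)) := by
    intro j
    refine (((hasSum_continuation z hN _ _ hs).mul_left _).mul_left _).congr_fun fun n => ?_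
    have he : e (j, n) = divModMap N (j, n) := rfl
    rw [Function.comp, he, latticeChar_divModMap hx, pt_eq_div hN, pt_eq_div hN, kern_div z s hN]
    rw [mul_left_comm, inv_mul_cancel_left₀ hN2]
    rfl
  have h := (hsum.prod_fiberwise hfib).unique (hasSum_fintype _)
  rw [twisted, h, Finset.mul_sum]

theorem continuousAt_continuation (z : ℍ) {N : ℕ} (hN : 0 < N) (A B : ℤ) :
    ContinuousAt (continuation z N A B) 0 := by
  have ho : IsOpen {s : ℂ | -(1 / 2) < s.re} := isOpen_lt continuous_const Complex.continuous_re
  exact (((differentiableOn_tsum_diffTerm z hN A B).add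
    (differentiableOn_integralPart z N A)).differentiableAt
      (ho.mem_nhds (by simp))).continuousAt

theorem tendsto_ofReal_nhdsGT_zero : Tendsto (fun t : ℝ => (t : ℂ)) (𝓝[>] 0) (𝓝 0) := by
  have : Tendsto (fun t : ℝ => (t : ℂ)) (𝓝 0) (𝓝 ((0 : ℝ) : ℂ)) :=
    Complex.continuous_ofReal.tendsto 0
  simpa using this.mono_left nhdsWithin_le_nhds

/-- The series on the left does not involve `N`, so uniqueness of limits makes `phiLevel`
independent of the level. -/
theorem tendsto_twisted (z : ℍ) {N : ℕ} (hN : 0 < N) {x : S} (hx : N • x = 0) :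
    Tendsto (fun t : ℝ => twisted z x t) (𝓝[>] 0)
      (𝓝 (4 * (Real.pi : ℂ) ^ 2 * phiLevel N x z)) := by
  have hN' : (N : ℂ) ≠ 0 := by exact_mod_cast hN.ne'
  have hpi : (Real.pi : ℂ) ≠ 0 := by exact_mod_cast Real.pi_ne_zero
  have hG : ∀ j : Fin 2 → Fin N, G (fun i => (((j i : ℕ) : ℚ) / (N : ℚ) : ℚ)) z =
      continuation z N ((j 0 : ℕ) : ℤ) ((j 1 : ℕ) : ℤ) 0 := by
    intro j
    rw [← (isContinuation_continuation z hN _ _).G_eq]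
    congr 1
    ext i
    fin_cases i <;> simp [ratPoint]
  have hc : ContinuousAt (fun s : ℂ => ((N : ℂ) ^ 2 * (N : ℂ) ^ s)⁻¹ * ∑ j : Fin 2 → Fin N,
      expQ ((j 1 : ℕ) • x 0 - (j 0 : ℕ) • x 1) *
        continuation z N ((j 0 : ℕ) : ℤ) ((j 1 : ℕ) : ℤ) s) 0 := by
    refine ContinuousAt.mul (ContinuousAt.inv₀ ?_ ?_) ?_
    · exact continuousAt_const.mul (continuousAt_const_cpow hN')
    · simpa using hN'
    · exact tendsto_finsetSum _ fun j _ =>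
        continuousAt_const.mul (continuousAt_continuation z hN _ _)
  have h := hc.tendsto.comp tendsto_ofReal_nhdsGT_zero
  convert h.congr' ?_ using 2
  · rw [phiLevel]
    simp_rw [hG]
    rw [Complex.cpow_zero, mul_one]
    field_simp
  · filter_upwards [self_mem_nhdsWithin] with t ht
    exact (twisted_eq_sum z hN hx (by simpa using ht)).symm

theorem exists_nsmul_eq_zero (x : S) : ∃ N : ℕ, 0 < N ∧ N • x = 0 := by
  obtain ⟨N, A, B, hN, rfl⟩ := exists_eq_ratPoint x
  have hN' : (N : ℚ) ≠ 0 := by exact_mod_cast hN.ne'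
  have key : ∀ A : ℤ, N • (((A : ℚ) / N : ℚ) : AddCircle (1 : ℚ)) = 0 := by
    intro A
    change ((N • ((A : ℚ) / N) : ℚ) : AddCircle (1 : ℚ)) = ((0 : ℚ) : AddCircle (1 : ℚ))
    refine (coe_eq_coe_iff_exists _ _).2 ⟨A, ?_⟩
    rw [nsmul_eq_mul]
    field_simp
    ring
  refine ⟨N, hN, ?_⟩
  ext i
  fin_cases i
  · exact key A
  · exact key B

theorem phiLevel_eq_phi {x : S} {N : ℕ} (hN : 0 < N) (hx : N • x = 0) :
    phiLevel N x = phi x := by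
  funext z
  have hpi : (4 * (Real.pi : ℂ) ^ 2) ≠ 0 :=
    mul_ne_zero (by norm_num) (pow_ne_zero _ (by exact_mod_cast Real.pi_ne_zero))
  have h1 := tendsto_twisted z hN hx
  have h2 := tendsto_twisted z (addOrderOf_pos_iff.2 (isOfFinAddOrder_iff_nsmul_eq_zero.2
    ⟨N, hN, hx⟩)) (addOrderOf_nsmul_eq_zero x)
  exact mul_left_cancel₀ hpi (tendsto_nhds_unique h1 h2)

theorem tendsto_twisted_phi (z : ℍ) (x : S) :
    Tendsto (fun t : ℝ => twisted z x t) (𝓝[>] 0) (𝓝 (4 * (Real.pi : ℂ) ^ 2 * phi x z)) := by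
  obtain ⟨N, hN, hx⟩ := exists_nsmul_eq_zero x
  rw [← phiLevel_eq_phi hN hx]
  exact tendsto_twisted z hN hx

end

/-! ### Characters trivial on `ℤ²A`, orthogonality, and the sum of the `φ_y`. -/

section

open Filter Topology

variable {A : Matrix (Fin 2) (Fin 2) ℤ}

theorem rowMul_apply (y : S) (A : Matrix (Fin 2) (Fin 2) ℤ) (j : Fin 2) :
    rowMul y A j = A 0 j • y 0 + A 1 j • y 1 := by
  simp [rowMul, Fin.sum_univ_two]

/-- The right multiplication by an integral matrix on `(ℚ/ℤ)²`. -/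
def rowMulHom (A : Matrix (Fin 2) (Fin 2) ℤ) : S →+ S where
  toFun y := rowMul y A
  map_zero' := by ext j; simp [rowMul_apply]
  map_add' x y := by
    ext j
    simp only [rowMul_apply, Pi.add_apply, smul_add]
    abel

/-- The homomorphism `k ↦ k A / det A` from `ℤ²` to `(ℚ/ℤ)²`. -/
def torsionHom (A : Matrix (Fin 2) (Fin 2) ℤ) : (Fin 2 → ℤ) →+ S where
  toFun k := fun j => ((((k 0 * A 0 j + k 1 * A 1 j : ℤ) : ℚ) / (A.det : ℚ) : ℚ) :
    AddCircle (1 : ℚ))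
  map_zero' := by ext j; simp
  map_add' k l := by
    ext j
    change _ = ((_ : ℚ) : AddCircle (1 : ℚ)) + ((_ : ℚ) : AddCircle (1 : ℚ))
    rw [← AddCircle.coe_add]
    congr 1
    simp only [Pi.add_apply]
    push_cast
    ring

theorem torsionHom_apply (A : Matrix (Fin 2) (Fin 2) ℤ) (k : Fin 2 → ℤ) (j : Fin 2) :
    torsionHom A k j = ((((k 0 * A 0 j + k 1 * A 1 j : ℤ) : ℚ) / (A.det : ℚ) : ℚ) :
      AddCircle (1 : ℚ)) := rfl

theorem coe_eq_zero_iff_exists (q : ℚ) : (q : AddCircle (1 : ℚ)) = 0 ↔ ∃ n : ℤ, q = n := by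
  have := coe_eq_coe_iff_exists q 0
  simpa using this

/-- Both inclusions come from `A · adj A = adj A · A = det A`: if a lift of `y` times `adj A` is an
integral vector `k`, then that lift is `kA / det A`. -/
theorem range_torsionHom (hA : A.det ≠ 0) :
    (torsionHom A).range = (rowMulHom A.adjugate).ker := by
  have hD : (A.det : ℚ) ≠ 0 := by exact_mod_cast hA
  have hdet : (A.det : ℚ) = A 0 0 * A 1 1 - A 0 1 * A 1 0 := by
    rw [Matrix.det_fin_two]; push_cast; ring
  ext y
  constructor
  · rintro ⟨k, rfl⟩
    rw [AddMonoidHom.mem_ker]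
    change rowMul _ _ = 0
    ext j
    rw [rowMul_apply, torsionHom_apply, torsionHom_apply, Pi.zero_apply, ← AddCircle.coe_zsmul,
      ← AddCircle.coe_zsmul, ← AddCircle.coe_add, coe_eq_zero_iff_exists]
    refine ⟨k j, ?_⟩
    fin_cases j
    · simp [Matrix.adjugate_fin_two]
      field_simp
      rw [hdet]; ring
    · simp [Matrix.adjugate_fin_two]
      field_simp
      rw [hdet]; ring
  · intro hy
    rw [AddMonoidHom.mem_ker] at hy
    change rowMul _ _ = 0 at hy
    obtain ⟨q, hq⟩ := QuotientAddGroup.mk_surjective (y 0)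
    obtain ⟨r, hr⟩ := QuotientAddGroup.mk_surjective (y 1)
    have hq' : y 0 = (q : AddCircle (1 : ℚ)) := hq.symm
    have hr' : y 1 = (r : AddCircle (1 : ℚ)) := hr.symm
    have h : ∀ j, ∃ n : ℤ, A.adjugate 0 j • q + A.adjugate 1 j • r = n := by
      intro j
      have := congrFun hy j
      rwa [rowMul_apply, hq', hr', Pi.zero_apply, ← AddCircle.coe_zsmul, ← AddCircle.coe_zsmul,
        ← AddCircle.coe_add, coe_eq_zero_iff_exists] at this
    choose k hk using h
    have h0 := hk 0
    have h1 := hk 1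
    simp [Matrix.adjugate_fin_two] at h0 h1
    refine ⟨k, ?_⟩
    ext j
    fin_cases j
    · change torsionHom A k 0 = y 0
      rw [torsionHom_apply, hq']
      congr 1
      rw [Int.cast_add, Int.cast_mul, Int.cast_mul, ← h0, ← h1]
      field_simp
      rw [hdet]; ring
    · change torsionHom A k 1 = y 1
      rw [torsionHom_apply, hr']
      congr 1
      rw [Int.cast_add, Int.cast_mul, Int.cast_mul, ← h0, ← h1]
      field_simp
      rw [hdet]; ring

theorem ker_torsionHom (hA : A.det ≠ 0) :
    (torsionHom A).ker = (LinearMap.range A.adjugate.vecMulLinear).toAddSubgroup := by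
  have hD : (A.det : ℚ) ≠ 0 := by exact_mod_cast hA
  ext k
  rw [AddMonoidHom.mem_ker, Submodule.mem_toAddSubgroup, LinearMap.mem_range]
  have hdet := Matrix.det_fin_two A
  constructor
  · intro h
    have hl : ∀ j, ∃ n : ℤ, k 0 * A 0 j + k 1 * A 1 j = n * A.det := by
      intro j
      have := congrFun h j
      rw [torsionHom_apply, Pi.zero_apply, coe_eq_zero_iff_exists] at this
      obtain ⟨n, hn⟩ := this
      rw [div_eq_iff hD] at hn
      exact ⟨n, by exact_mod_cast hn⟩
    choose l hl using hl
    have h0 := hl 0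
    have h1 := hl 1
    refine ⟨l, ?_⟩
    ext j
    apply mul_left_cancel₀ hA
    fin_cases j
    · simp [Matrix.vecMul, dotProduct, Fin.sum_univ_two, Matrix.adjugate_fin_two,
        -mul_eq_mul_left_iff]
      linear_combination (k 0) * hdet.symm - A 1 1 * h0 + A 1 0 * h1
    · simp [Matrix.vecMul, dotProduct, Fin.sum_univ_two, Matrix.adjugate_fin_two,
        -mul_eq_mul_left_iff]
      linear_combination (k 1) * hdet.symm + A 0 1 * h0 - A 0 0 * h1
  · rintro ⟨l, rfl⟩
    ext j
    rw [torsionHom_apply, Pi.zero_apply, coe_eq_zero_iff_exists]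
    refine ⟨l j, ?_⟩
    rw [div_eq_iff hD]
    norm_cast
    fin_cases j
    · simp [Matrix.vecMul, dotProduct, Fin.sum_univ_two, Matrix.adjugate_fin_two]
      rw [hdet]; ring
    · simp [Matrix.vecMul, dotProduct, Fin.sum_univ_two, Matrix.adjugate_fin_two]
      rw [hdet]; ring

/-- By the two preceding results the group is `ℤ² / ℤ² adj A`, whose order is `|det (adj A)|`; for
`2 × 2` matrices this is `|det A|`. -/
theorem card_ker_rowMulHom (hA : A.det ≠ 0) :
    Nat.card (rowMulHom A.adjugate).ker = A.det.natAbs := by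
  have hadj : A.adjugate.det = A.det := by simp [Matrix.det_adjugate]
  have hinj : Function.Injective A.adjugate.vecMulLinear := by
    rw [← LinearMap.ker_eq_bot, LinearMap.ker_eq_bot']
    exact fun l hl => Matrix.eq_zero_of_vecMul_eq_zero (hadj.trans_ne hA) hl
  have h := Submodule.natAbs_det_equiv (LinearMap.range A.adjugate.vecMulLinear)
    (LinearEquiv.ofInjective _ hinj)
  have hcomp : (LinearMap.range A.adjugate.vecMulLinear).subtype ∘ₗ AddMonoidHom.toIntLinearMap
      ((LinearEquiv.ofInjective _ hinj : (Fin 2 → ℤ) ≃ₗ[ℤ] _) : (Fin 2 → ℤ) →+ _) =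
      Matrix.toLin' A.adjugate.transpose := by
    ext l j
    simp
  rw [hcomp, LinearMap.det_toLin', Matrix.det_transpose, hadj] at h
  rw [← range_torsionHom hA, ← AddSubgroup.index_ker, ker_torsionHom hA, h]
  rfl

theorem latticeChar_add (x y : S) (n : ℤ × ℤ) :
    latticeChar (x + y) n = latticeChar x n * latticeChar y n := by
  rw [latticeChar, latticeChar, latticeChar, ← expQ_add]
  congr 1
  simp only [Pi.add_apply, smul_add]
  abel

/-- The right multiplication by an integral matrix on `ℤ²`. -/
def latticeMap (A : Matrix (Fin 2) (Fin 2) ℤ) (l : ℤ × ℤ) : ℤ × ℤ :=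
  (l.1 * A 0 0 + l.2 * A 1 0, l.1 * A 0 1 + l.2 * A 1 1)

theorem latticeMap_injective (hA : A.det ≠ 0) : Function.Injective (latticeMap A) := by
  rintro ⟨p, q⟩ ⟨p', q'⟩ h
  have h0 : p * A 0 0 + q * A 1 0 = p' * A 0 0 + q' * A 1 0 := congrArg Prod.fst h
  have h1 : p * A 0 1 + q * A 1 1 = p' * A 0 1 + q' * A 1 1 := congrArg Prod.snd h
  have hdet := Matrix.det_fin_two A
  refine Prod.ext (mul_left_cancel₀ hA ?_) (mul_left_cancel₀ hA ?_)
  · linear_combination (p - p') * hdet + A 1 1 * h0 - A 1 0 * h1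
  · linear_combination (q - q') * hdet - A 0 1 * h0 + A 0 0 * h1

/-- For the alternating pairing `n₂x₁ - n₁x₂` the adjoint of `A` is its adjugate, so `lA` pairs with
`y` as `l` pairs with `y · adj A`. The converse tests `n` against the two rows of `A / det A`. -/
theorem mem_range_latticeMap_iff (hA : A.det ≠ 0) (n : ℤ × ℤ) :
    n ∈ Set.range (latticeMap A) ↔ ∀ y ∈ (rowMulHom A.adjugate).ker, latticeChar y n = 1 := by
  have hD : (A.det : ℚ) ≠ 0 := by exact_mod_cast hA
  have hdet := Matrix.det_fin_two A
  constructor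
  · rintro ⟨l, rfl⟩ y hy
    rw [AddMonoidHom.mem_ker] at hy
    have h0 : rowMul y A.adjugate 0 = 0 := congrFun hy 0
    have h1 : rowMul y A.adjugate 1 = 0 := congrFun hy 1
    rw [rowMul_apply] at h0 h1
    rw [latticeChar, expQ_eq_one_iff]
    have : (latticeMap A l).2 • y 0 - (latticeMap A l).1 • y 1 =
        l.2 • (A.adjugate 0 0 • y 0 + A.adjugate 1 0 • y 1) -
        l.1 • (A.adjugate 0 1 • y 0 + A.adjugate 1 1 • y 1) := by
      simp only [latticeMap, Matrix.adjugate_fin_two, Matrix.of_apply, Matrix.cons_val_zero,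
        Matrix.cons_val_one, Matrix.cons_val', Matrix.cons_val_fin_one]
      module
    rw [this, h0, h1, smul_zero, smul_zero, sub_zero]
  · intro h
    have hl : ∀ k : Fin 2 → ℤ, ∃ m : ℤ, n.2 * (k 0 * A 0 0 + k 1 * A 1 0) -
        n.1 * (k 0 * A 0 1 + k 1 * A 1 1) = m * A.det := by
      intro k
      have hk := h (torsionHom A k) (range_torsionHom hA ▸ ⟨k, rfl⟩)
      rw [latticeChar, expQ_eq_one_iff, torsionHom_apply, torsionHom_apply, ← AddCircle.coe_zsmul,
        ← AddCircle.coe_zsmul, ← AddCircle.coe_sub, coe_eq_zero_iff_exists] at hk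
      obtain ⟨m, hm⟩ := hk
      refine ⟨m, ?_⟩
      rw [zsmul_eq_mul, zsmul_eq_mul, ← mul_div_assoc, ← mul_div_assoc, ← sub_div,
        div_eq_iff hD] at hm
      exact_mod_cast hm
    obtain ⟨l, hl0⟩ := hl ![1, 0]
    obtain ⟨m, hm0⟩ := hl ![0, 1]
    simp at hl0 hm0
    -- Cramer's rule: the two pairings, divided by `det A`, are up to sign and order the coordinates
    -- of the preimage.
    refine ⟨(-m, l), Prod.ext (mul_left_cancel₀ hA ?_) (mul_left_cancel₀ hA ?_)⟩
    · simp only [latticeMap]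
      linear_combination -n.1 * hdet + A 0 0 * hm0 - A 1 0 * hl0
    · simp only [latticeMap]
      linear_combination -n.2 * hdet + A 0 1 * hm0 - A 1 1 * hl0

open Classical in
theorem sum_latticeChar (hA : A.det ≠ 0) [Fintype (rowMulHom A.adjugate).ker] (n : ℤ × ℤ) :
    ∑ y : (rowMulHom A.adjugate).ker, latticeChar y n =
      if n ∈ Set.range (latticeMap A) then (A.det.natAbs : ℂ) else 0 := by
  split_ifs with hn
  · rw [mem_range_latticeMap_iff hA] at hn
    rw [Finset.sum_congr rfl fun (y : (rowMulHom A.adjugate).ker) _ => hn y y.2,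
      Finset.sum_const, nsmul_one, Finset.card_univ,
      ← Nat.card_eq_fintype_card, card_ker_rowMulHom hA]
  · rw [mem_range_latticeMap_iff hA] at hn
    push Not at hn
    obtain ⟨y₀, hy₀, hne⟩ := hn
    -- Translation by `y₀` permutes the group and multiplies the sum by a number different from `1`,
    -- so the sum is zero.
    have h := Fintype.sum_equiv (Equiv.addLeft (⟨y₀, hy₀⟩ : (rowMulHom A.adjugate).ker))
      (fun y => latticeChar y₀ n * latticeChar y n) (fun y => latticeChar y n)
      (fun y => (latticeChar_add y₀ y n).symm)
    rw [← Finset.mul_sum] at h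
    by_contra h0
    exact hne ((mul_eq_right₀ h0).1 h)

theorem sum_twisted (hA : A.det ≠ 0) [Fintype (rowMulHom A.adjugate).ker] (z : ℍ) {s : ℂ}
    (hs : 0 < s.re) :
    ∑ y : (rowMulHom A.adjugate).ker, twisted z y s = (A.det.natAbs : ℂ) *
      ∑' l : ℤ × ℤ, kern z s (latticeMap A l).1 (latticeMap A l).2 := by
  classical
  simp only [twisted]
  rw [← Summable.tsum_finsetSum fun (y : (rowMulHom A.adjugate).ker) _ => summable_twisted z y hs]
  simp_rw [← Finset.sum_mul, sum_latticeChar hA, ite_mul, zero_mul]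
  rw [← tsum_mul_left, ← (latticeMap_injective hA).tsum_eq (f := fun n : ℤ × ℤ =>
    if n ∈ Set.range (latticeMap A) then (A.det.natAbs : ℂ) * kern z s n.1 n.2 else 0)]
  · simp
  · intro n hn
    by_contra h
    exact hn (if_neg h)

/-- The linear form of `lA` at `z` is `cz + d` times the linear form of `l` at `γz`. -/
theorem kern_latticeMap {γ : GL(2, ℚ)⁺}
    (hγ : ((γ : GL (Fin 2) ℚ) : Matrix (Fin 2) (Fin 2) ℚ) = A.map (Int.cast : ℤ → ℚ))
    (z : ℍ) (s : ℂ) (l : ℤ × ℤ) :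
    kern z s (latticeMap A l).1 (latticeMap A l).2 =
      (denom (toReal γ) z ^ 2)⁻¹ * ((‖denom (toReal γ) z‖ : ℝ) : ℂ) ^ (-s) *
        kern (toReal γ • z) s l.1 l.2 := by
  have hent : ∀ i j, (toReal γ : Matrix (Fin 2) (Fin 2) ℝ) i j = A i j := by
    intro i j
    have := congrFun (congrFun hγ i) j
    simp [toReal, this]
  have hd := denom_ne_zero (toReal γ) z
  have hlin : (((latticeMap A l).1 : ℝ) : ℂ) * z + ((latticeMap A l).2 : ℝ) =
      denom (toReal γ) z * (((l.1 : ℝ) : ℂ) * (toReal γ • z : ℍ) + (l.2 : ℝ)) := by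
    rw [coe_smul_of_det_pos (toReal_det_pos γ), mul_add, mul_left_comm, mul_div_cancel₀ _ hd]
    simp [num, denom, hent, latticeMap]
    ring
  rw [kern, kern, hlin, norm_mul, Complex.ofReal_mul,
    Complex.mul_cpow_ofReal_nonneg (norm_nonneg _) (norm_nonneg _), mul_pow, mul_inv]
  ring

theorem latticeChar_zero (n : ℤ × ℤ) : latticeChar 0 n = 1 := by
  simp [latticeChar, expQ_zero]

theorem det_pos_of_eq_map {γ : GL(2, ℚ)⁺}
    (hγ : ((γ : GL (Fin 2) ℚ) : Matrix (Fin 2) (Fin 2) ℚ) = A.map (Int.cast : ℤ → ℚ)) :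
    0 < A.det ∧ (toReal γ).det.val = A.det := by
  have h1 : (γ : GL (Fin 2) ℚ).det.val = (A.det : ℚ) := by
    rw [Matrix.GeneralLinearGroup.val_det_apply, hγ]
    exact ((Int.castRingHom ℚ).map_det A).symm
  have h2 : (toReal γ).det.val = (((γ : GL (Fin 2) ℚ).det.val : ℚ) : ℝ) := by
    simp [toReal, Matrix.GeneralLinearGroup.map_det]
  have h3 : 0 < (γ : GL (Fin 2) ℚ).det.val := γ.2
  rw [h1] at h2 h3
  exact ⟨by exact_mod_cast h3, by exact_mod_cast h2⟩

theorem sum_phi_eq_slash {γ : GL(2, ℚ)⁺}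
    (hγ : ((γ : GL (Fin 2) ℚ) : Matrix (Fin 2) (Fin 2) ℚ) = A.map (Int.cast : ℤ → ℚ))
    [Fintype (rowMulHom A.adjugate).ker] (z : ℍ) :
    ∑ y : (rowMulHom A.adjugate).ker, phi y z = slash 2 phiZero γ z := by
  obtain ⟨hpos, hdet⟩ := det_pos_of_eq_map hγ
  have hpi : (4 * (Real.pi : ℂ) ^ 2) ≠ 0 :=
    mul_ne_zero (by norm_num) (pow_ne_zero _ (by exact_mod_cast Real.pi_ne_zero))
  have hd := denom_ne_zero (toReal γ) z
  have h1 : Tendsto (fun t : ℝ => ∑ y : (rowMulHom A.adjugate).ker, twisted z y t) (𝓝[>] 0)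
      (𝓝 (∑ y : (rowMulHom A.adjugate).ker, 4 * (Real.pi : ℂ) ^ 2 * phi y z)) :=
    tendsto_finsetSum _ fun y _ => tendsto_twisted_phi z y
  have h2 : Tendsto (fun t : ℝ => (A.det.natAbs : ℂ) * ((denom (toReal γ) z ^ 2)⁻¹ *
      ((‖denom (toReal γ) z‖ : ℝ) : ℂ) ^ (-(t : ℂ)) * twisted (toReal γ • z) 0 t)) (𝓝[>] 0)
      (𝓝 ((A.det.natAbs : ℂ) * ((denom (toReal γ) z ^ 2)⁻¹ * 1 *
        (4 * (Real.pi : ℂ) ^ 2 * phi 0 (toReal γ • z))))) := by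
    refine (Tendsto.mul (Tendsto.mul tendsto_const_nhds ?_) (tendsto_twisted_phi _ 0)).const_mul _
    have hc : ContinuousAt (fun s : ℂ => ((‖denom (toReal γ) z‖ : ℝ) : ℂ) ^ (-s)) 0 :=
      (continuousAt_const_cpow (by simp [hd])).comp continuous_neg.continuousAt
    simpa [Function.comp_def] using hc.tendsto.comp tendsto_ofReal_nhdsGT_zero
  have h3 := tendsto_nhds_unique h1 (h2.congr' ?_)
  · rw [← Finset.mul_sum, phi_zero] at h3
    refine mul_left_cancel₀ hpi (h3.trans ?_)
    -- The order of the character group is the factor `det(γ)^{2/2}` of the slash operator of weight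
    -- 2.
    have hn : (A.det.natAbs : ℂ) = A.det := by
      rw [← Int.cast_natCast, Int.natAbs_of_nonneg hpos.le]
    rw [slash, hdet, hn]
    norm_num
    ring
  · filter_upwards [self_mem_nhdsWithin] with t ht
    rw [sum_twisted hpos.ne' z (by simpa using ht)]
    simp_rw [kern_latticeMap hγ, twisted, latticeChar_zero, one_mul]
    rw [tsum_mul_left]

theorem finite_rowMul_eq_zero (hA : A.det ≠ 0) :
    {y : S | rowMul y A.adjugate = 0}.Finite := by
  have : Finite (rowMulHom A.adjugate).ker :=
    Nat.finite_of_card_ne_zero (by rwa [card_ker_rowMulHom hA, Int.natAbs_ne_zero])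
  exact Set.toFinite ((rowMulHom A.adjugate).ker : Set S)

theorem finsum_phi_eq_slash {γ : GL(2, ℚ)⁺}
    (hγ : ((γ : GL (Fin 2) ℚ) : Matrix (Fin 2) (Fin 2) ℚ) = A.map (Int.cast : ℤ → ℚ)) (z : ℍ) :
    ∑ᶠ y ∈ {y : S | rowMul y A.adjugate = 0}, phi y z = slash 2 phiZero γ z := by
  have hfin := finite_rowMul_eq_zero (det_pos_of_eq_map hγ).1.ne'
  have : Fintype (rowMulHom A.adjugate).ker := hfin.fintype
  rw [← sum_phi_eq_slash hγ z, ← finsum_eq_sum_of_fintype]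
  exact (finsum_set_coe_eq_finsum_mem ((rowMulHom A.adjugate).ker : Set S)
    (f := fun y => phi y z)).symm

end

end HeckeEisenstein

end

theorem mainTheorem8 :
    -- the series `G_a(z, s)` extend analytically to `s = 0`
    (∀ (a : HeckeEisenstein.S) (z : UpperHalfPlane),
      ∃ F : ℂ → ℂ, HeckeEisenstein.IsContinuation a z F) ∧
    -- `φ_x` can be formed at any level `N` with `N x = 0`
    (∀ (x : HeckeEisenstein.S) (N : ℕ), 0 < N → N • x = 0 →
      HeckeEisenstein.phiLevel N x = HeckeEisenstein.phi x) ∧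
    -- `μ_γ = 2 (φ_0|γ - φ_0)`
    (∀ (γ : GL(2, ℚ)⁺) (z : UpperHalfPlane),
      HeckeEisenstein.mu γ z =
        2 * (HeckeEisenstein.slash 2 HeckeEisenstein.phiZero γ z -
          HeckeEisenstein.phiZero z)) ∧
    -- for integral `γ`, with `γ̌ = det(γ) γ⁻¹` the adjugate of `γ`:
    -- `μ_γ = 2 (∑_{y γ̌ = 0} φ_y - φ_0)`, a finite sum
    (∀ (γ : GL(2, ℚ)⁺) (A : Matrix (Fin 2) (Fin 2) ℤ),
      ((γ : GL (Fin 2) ℚ) : Matrix (Fin 2) (Fin 2) ℚ) = A.map (Int.cast : ℤ → ℚ) →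
      {y : HeckeEisenstein.S | HeckeEisenstein.rowMul y A.adjugate = 0}.Finite ∧
      ∀ z : UpperHalfPlane,
        HeckeEisenstein.mu γ z =
          2 * ((∑ᶠ y ∈ {y : HeckeEisenstein.S |
              HeckeEisenstein.rowMul y A.adjugate = 0}, HeckeEisenstein.phi y z) -
            HeckeEisenstein.phiZero z)) := by
  refine ⟨HeckeEisenstein.exists_isContinuation,
    fun x N hN hx => HeckeEisenstein.phiLevel_eq_phi hN hx, HeckeEisenstein.mu_eq,
    fun γ A hγ => ⟨HeckeEisenstein.finite_rowMul_eq_zero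
      (HeckeEisenstein.det_pos_of_eq_map hγ).1.ne', fun z => ?_⟩⟩
  rw [HeckeEisenstein.finsum_phi_eq_slash hγ z]
  exact HeckeEisenstein.mu_eq γ z
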